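/- Let $n\ge 4$ be an even integer, let $u\in C^\infty(\mathbb{R}^n)$, and consider the conformal metric $g=e^{2u}|dx|^2$ on $\mathbb{R}^n$. Let $R_g$ be the scalar curvature of $g$, and let $Q$ be its Q-curvature, that is, the function determined by $(-\Delta)^{n/2}u=Q\,e^{nu}$, where $\Delta$ is the Euclidean Laplacian. Assume that $g$ has finite total Q-curvature, i.e. $Qe^{nu}\in L^1(\mathbb{R}^n)$, and that $R_g\ge 0$ outside some compact subset of $\mathbb{R}^n$. If $$\int_{\mathbb{R}^n}Qe^{nu}\,dx<\frac{(n-1)!\,|\mathbb{S}^n|}{2},$$ where $|\mathbb{S}^n|$ denotes the volume of the standard unit $n$-sphere, then the metric $g$ is complete. -/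

import Mathlib

open MeasureTheory
open scoped ContDiff Manifold Laplacian

noncomputable section

/-- `ℝⁿ` with its Euclidean norm. -/
abbrev Euc (n : ℕ) : Type := EuclideanSpace ℝ (Fin n)

/-- A field of bilinear forms on `ℝⁿ`, given by its components `g_{ij}(x)` in the standard
coordinates. -/
abbrev MetricField (n : ℕ) : Type := Euc n → Matrix (Fin n) (Fin n) ℝ

/-- The conformal metric `g = e^{2u} |dx|²`. -/
def conformalMetric {n : ℕ} (u : Euc n → ℝ) : MetricField n :=
  fun x => Real.exp (2 * u x) • (1 : Matrix (Fin n) (Fin n) ℝ)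

/-! ### Curvature in the standard coordinates -/

/-- The partial derivative `∂_i f`. -/
def partialDeriv {n : ℕ} (i : Fin n) (f : Euc n → ℝ) (x : Euc n) : ℝ :=
  fderiv ℝ f x (EuclideanSpace.single i 1)

/-- The Christoffel symbol
`Γ^k_{ij} = (1/2) ∑_l g^{kl} (∂_i g_{jl} + ∂_j g_{il} - ∂_l g_{ij})`. -/
def christoffel {n : ℕ} (g : MetricField n) (k i j : Fin n) (x : Euc n) : ℝ :=
  (1 / 2) * ∑ l, (g x)⁻¹ k l *
    (partialDeriv i (fun y => g y j l) x + partialDeriv j (fun y => g y i l) x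
      - partialDeriv l (fun y => g y i j) x)

/-- The Ricci tensor
`R_{ij} = ∑_k (∂_k Γ^k_{ij} - ∂_j Γ^k_{ik}) + ∑_{k,l} (Γ^k_{kl} Γ^l_{ij} - Γ^k_{jl} Γ^l_{ik})`
(positive on round spheres). -/
def ricciTensor {n : ℕ} (g : MetricField n) (i j : Fin n) (x : Euc n) : ℝ :=
  ∑ k, (partialDeriv k (christoffel g k i j) x - partialDeriv j (christoffel g k i k) x)
    + ∑ k, ∑ l, (christoffel g k k l x * christoffel g l i j x
        - christoffel g k j l x * christoffel g l i k x)

/-- The scalar curvature `R_g = ∑_{i,j} g^{ij} R_{ij}`. -/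
def scalarCurvature {n : ℕ} (g : MetricField n) (x : Euc n) : ℝ :=
  ∑ i, ∑ j, (g x)⁻¹ i j * ricciTensor g i j x

/-- The Q-curvature of `g = e^{2u} |dx|²` on `ℝⁿ`, `n` even: the function `Q` determined by
`(-Δ)^{n/2} u = Q e^{nu}`, with `Δ` the Euclidean Laplacian. -/
def qCurvature {n : ℕ} (u : Euc n → ℝ) (x : Euc n) : ℝ :=
  Real.exp (-(n * u x)) * (fun f : Euc n → ℝ => -Δ f)^[n / 2] u x

/-- The volume `|𝕊ⁿ|` of the standard unit sphere in `ℝ^{n+1}`. -/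
def sphereVolume (n : ℕ) : ℝ :=
  (volume : Measure (Euc (n + 1))).toSphere.real Set.univ

/-! ### The distance of a metric and completeness -/

/-- The length `√(g_x(v, v))` of a tangent vector `v` at `x`. -/
def tangentLength {n : ℕ} (g : MetricField n) (x v : Euc n) : ℝ :=
  √(∑ i, ∑ j, g x i j * v i * v j)

theorem tangentLength_smul {n : ℕ} (g : MetricField n) (x : Euc n) (c : ℝ) (v : Euc n) :
    tangentLength g x (c • v) = |c| * tangentLength g x v := by
  unfold tangentLength
  rw [← Real.sqrt_sq_eq_abs, ← Real.sqrt_mul (sq_nonneg c), Finset.mul_sum]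
  congr 1
  refine Finset.sum_congr rfl fun i _ => ?_
  rw [Finset.mul_sum]
  refine Finset.sum_congr rfl fun j _ => ?_
  simp only [PiLp.smul_apply, smul_eq_mul]
  ring

/-- The norm that the metric puts on each tangent space of `ℝⁿ`. -/
@[reducible] def tangentENorm {n : ℕ} (g : MetricField n) (x : Euc n) :
    ENorm (TangentSpace 𝓘(ℝ, Euc n) x) :=
  ⟨fun v => ENNReal.ofReal (tangentLength g x v)⟩

theorem tangentENorm_smulClass {n : ℕ} (g : MetricField n) (x : Euc n) :
    letI := tangentENorm g x
    ENormSMulClass ℝ (TangentSpace 𝓘(ℝ, Euc n) x) :=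
  let _ := tangentENorm g x
  ⟨fun c v => by
    have h (w : Euc n) : ENNReal.ofReal (tangentLength g x (c • w)) =
        ‖c‖ₑ * ENNReal.ofReal (tangentLength g x w) := by
      rw [tangentLength_smul, ENNReal.ofReal_mul (abs_nonneg c), Real.enorm_eq_ofReal_abs]
    exact h v⟩

/-- The geodesic distance of a metric on `ℝⁿ`: the infimum of the lengths of the `C¹` curves that
join the two points. -/
def geodesicEDist {n : ℕ} (g : MetricField n) (x y : Euc n) : ENNReal :=
  letI := tangentENorm g
  Manifold.riemannianEDist 𝓘(ℝ, Euc n) x y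

/-- `ℝⁿ` with the geodesic distance of `g`, and the uniformity of that distance. -/
@[reducible] def geodesicSpace {n : ℕ} (g : MetricField n) : PseudoEMetricSpace (Euc n) where
  edist := geodesicEDist g
  edist_self x := by
    let _ := tangentENorm g
    have _ := tangentENorm_smulClass g
    exact Manifold.riemannianEDist_self
  edist_comm x y := by
    let _ := tangentENorm g
    have _ := tangentENorm_smulClass g
    exact Manifold.riemannianEDist_comm
  edist_triangle x y z := by
    let _ := tangentENorm g
    have _ := tangentENorm_smulClass g
    exact Manifold.riemannianEDist_triangle

/-- The metric is complete: Cauchy sequences for its geodesic distance converge. -/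
def IsCompleteMetric {n : ℕ} (g : MetricField n) : Prop :=
  @CompleteSpace (Euc n) (geodesicSpace g).toUniformSpace

end

open Filter Metric Set Module
open scoped Gradient RealInnerProductSpace Topology

/-!
Outside a compact set, `R_g ≥ 0` reads `(n-2)/2 |∇u|² ≤ -Δu`. Let `v_k` be the mean of `(-Δ)^k u`
over the sphere of radius `r` about the origin. Then `(r^{n-1} v_k')' = -r^{n-1} v_{k+1}`, and
Jensen's inequality gives the Riccati inequality `(n-2)/2 (v_0')² ≤ v_1`, which rules out every
solution of the radial system that grows faster than a logarithm. What is left is the logarithmic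
mode, fixed by the total Q-curvature: `r v_0'(r)` tends to minus the ratio of `∫ Q e^{nu}` to
`(n-1)! |𝕊ⁿ| / 2`, which is `> -1`, so `v_0 ≥ -log r - C`.

Tested against a cutoff function, the same inequality bounds the mean of `|∇u|²` over balls of
radius proportional to their distance from the origin, scale invariantly. So the means of `u` over
two such balls at comparable distance differ by a bounded amount; one of them dominates the
spherical means nearby, and superharmonicity passes from a ball to its centre, so
`u(x) ≥ -log |x| - C`. Hence `e^u ≥ a / (1 + |x|)`, and a multiple of `log (1 + |x|²)` is a
proper function which is 1-Lipschitz for the geodesic distance, so Cauchy sequences stay in a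
compact set.
-/

section Laplacian

variable {E : Type*} [NormedAddCommGroup E] [InnerProductSpace ℝ E] {u v χ : E → ℝ}

theorem fderiv_comp_add_smul (a : E) (ρ : ℝ) (y : E) :
    fderiv ℝ (fun z ↦ u (a + ρ • z)) y = ρ • fderiv ℝ u (a + ρ • y) := by
  rw [fderiv_comp_smul (f := fun z ↦ u (a + z)), fderiv_comp_add_left]

theorem fderiv_comp_norm_sq {Θ : ℝ → ℝ} (hΘ : Differentiable ℝ Θ) (x : E) :
    fderiv ℝ (fun y : E ↦ Θ (‖y‖ ^ 2)) x = deriv Θ (‖x‖ ^ 2) • (2 • innerSL ℝ x) :=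
  ((hΘ _).hasDerivAt.comp_hasFDerivAt x (hasStrictFDerivAt_norm_sq x).hasFDerivAt).fderiv

variable [FiniteDimensional ℝ E]

theorem hasCompactSupport_comp_norm_sq {Θ : ℝ → ℝ} {b : ℝ} (hΘ : ∀ t, b ^ 2 ≤ t → Θ t = 0) :
    HasCompactSupport fun x : E ↦ Θ (‖x‖ ^ 2) := by
  refine HasCompactSupport.intro (isCompact_closedBall 0 |b|) fun x hx ↦ hΘ _ ?_
  rw [mem_closedBall_zero_iff, not_le] at hx
  exact (sq_lt_sq.2 (hx.trans_le (le_abs_self _))).le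

theorem laplacian_eq_sum_fderiv_fderiv {ι : Type*} [Fintype ι] (b : OrthonormalBasis ι ℝ E)
    (hv : ContDiff ℝ 2 v) (x : E) :
    Δ v x = ∑ i, fderiv ℝ (fun y ↦ fderiv ℝ v y (b i)) x (b i) := by
  rw [InnerProductSpace.laplacian_eq_iteratedFDeriv_orthonormalBasis v b]
  refine Finset.sum_congr rfl fun i _ ↦ ?_
  have hdiff : DifferentiableAt ℝ (fderiv ℝ v) x :=
    (hv.fderiv_right (m := 1) le_rfl).differentiable one_ne_zero x
  rw [iteratedFDeriv_two_apply, fderiv_clm_apply hdiff (differentiableAt_const _)]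
  simp

theorem contDiff_laplacian {n : ℕ∞ω} (hv : ContDiff ℝ (n + 2) v) : ContDiff ℝ n (Δ v) := by
  have hΔ : Δ v = fun x ↦ ∑ i, fderiv ℝ (fun y ↦ fderiv ℝ v y (stdOrthonormalBasis ℝ E i)) x
      (stdOrthonormalBasis ℝ E i) :=
    funext (laplacian_eq_sum_fderiv_fderiv _ (hv.of_le le_add_self))
  have hv' : ContDiff ℝ (n + 1 + 1) v := by rwa [add_assoc, one_add_one_eq_two]
  rw [hΔ]
  refine ContDiff.sum fun i _ ↦ ContDiff.clm_apply ?_ contDiff_const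
  exact ((hv'.fderiv_right le_rfl).clm_apply contDiff_const).fderiv_right le_rfl

theorem contDiff_iterate_neg_laplacian (hu : ContDiff ℝ ∞ u) (k : ℕ) :
    ContDiff ℝ ∞ ((fun f : E → ℝ ↦ -Δ f)^[k] u) := by
  induction k with
  | zero => exact hu
  | succ k ih =>
    rw [Function.iterate_succ_apply']
    exact (contDiff_laplacian ih).neg

theorem laplacian_comp_add_smul (hu : ContDiff ℝ 2 u) (a : E) (ρ : ℝ) (y : E) :
    Δ (fun z ↦ u (a + ρ • z)) y = ρ ^ 2 * Δ u (a + ρ • y) := by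
  have hcomp (z : E) : iteratedFDeriv ℝ 2 (fun z ↦ u (a + ρ • z)) z =
      ρ ^ 2 • iteratedFDeriv ℝ 2 u (a + ρ • z) := by
    have hu' : ContDiff ℝ 2 fun z ↦ u (a + z) := by fun_prop
    rw [iteratedFDeriv_comp_const_smul ρ (f := fun z ↦ u (a + z)) hu']
    simp only [iteratedFDeriv_comp_add_left]
  simp_rw [InnerProductSpace.laplacian_eq_iteratedFDeriv_stdOrthonormalBasis, hcomp,
    Finset.mul_sum, smul_apply, smul_eq_mul]

theorem norm_gradient (v : E → ℝ) (x : E) : ‖∇ v x‖ = ‖fderiv ℝ v x‖ :=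
  LinearIsometryEquiv.norm_map _ _

theorem sum_fderiv_mul_fderiv_eq {ι : Type*} [Fintype ι] (b : OrthonormalBasis ι ℝ E)
    (f g : E → ℝ) (x : E) :
    ∑ i, fderiv ℝ f x (b i) * fderiv ℝ g x (b i) = fderiv ℝ f x (∇ g x) := by
  conv_rhs => rw [← b.sum_repr' (∇ g x), map_sum]
  refine Finset.sum_congr rfl fun i _ ↦ ?_
  rw [map_smul, smul_eq_mul, mul_comm, real_inner_comm, ← toDual_gradient (f := g),
    InnerProductSpace.toDual_apply_apply]

variable [MeasurableSpace E] [BorelSpace E]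

theorem integral_mul_laplacian (hχ : ContDiff ℝ 1 χ) (hc : HasCompactSupport χ)
    (hv : ContDiff ℝ 2 v) :
    ∫ x, χ x * Δ v x = -∫ x, fderiv ℝ χ x (∇ v x) := by
  let b := stdOrthonormalBasis ℝ E
  have hχ' (i) : Continuous fun x ↦ fderiv ℝ χ x (b i) :=
    (hχ.continuous_fderiv one_ne_zero).clm_apply continuous_const
  have hv' (i) : ContDiff ℝ 1 fun x ↦ fderiv ℝ v x (b i) :=
    (hv.fderiv_right le_rfl).clm_apply contDiff_const
  have hv'' (i) : Continuous fun x ↦ fderiv ℝ (fun y ↦ fderiv ℝ v y (b i)) x (b i) :=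
    ((hv' i).continuous_fderiv one_ne_zero).clm_apply continuous_const
  have hint {f g : E → ℝ} (hf : Continuous f) (hcf : HasCompactSupport f) (hg : Continuous g) :
      Integrable fun x ↦ f x * g x :=
    (hf.mul hg).integrable_of_hasCompactSupport hcf.mul_right
  have hint₁ (i) := hint (hχ' i) (hc.fderiv_apply (𝕜 := ℝ) (b i)) (hv' i).continuous
  have hint₂ (i) := hint hχ.continuous hc (hv'' i)
  simp_rw [laplacian_eq_sum_fderiv_fderiv b hv, ← sum_fderiv_mul_fderiv_eq b, Finset.mul_sum]
  rw [integral_finsetSum _ fun i _ ↦ hint₂ i, integral_finsetSum _ fun i _ ↦ hint₁ i,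
    ← Finset.sum_neg_distrib]
  exact Finset.sum_congr rfl fun i _ ↦ integral_mul_fderiv_eq_neg_fderiv_mul_of_integrable
    (hint₁ i) (hint₂ i) (hint hχ.continuous hc (hv' i).continuous)
    (fun x _ ↦ hχ.differentiable one_ne_zero x) (fun x _ ↦ (hv' i).differentiable one_ne_zero x)

theorem integral_radial_mul_laplacian {Θ : ℝ → ℝ} {b : ℝ} (hΘ : ContDiff ℝ 1 Θ)
    (hb : ∀ t, b ^ 2 ≤ t → Θ t = 0) (hv : ContDiff ℝ 2 v) :
    ∫ x, Θ (‖x‖ ^ 2) * Δ v x = -∫ x, 2 * deriv Θ (‖x‖ ^ 2) * fderiv ℝ v x x := by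
  rw [integral_mul_laplacian (χ := fun x ↦ Θ (‖x‖ ^ 2)) (hΘ.comp (contDiff_norm_sq ℝ))
    (hasCompactSupport_comp_norm_sq hb) hv]
  simp_rw [fderiv_comp_norm_sq (hΘ.differentiable one_ne_zero), ← toDual_gradient (f := v)]
  congr 2
  ext x
  simp
  ring

end Laplacian

section Curvature

variable {n : ℕ} {u : Euc n → ℝ}

theorem fderiv_basisFun (f : Euc n → ℝ) (x : Euc n) (i : Fin n) :
    fderiv ℝ f x (EuclideanSpace.basisFun (Fin n) ℝ i) = partialDeriv i f x := by
  rw [EuclideanSpace.basisFun_apply, partialDeriv]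

theorem contDiff_partialDeriv {k : ℕ∞ω} (hu : ContDiff ℝ (k + 1) u) (i : Fin n) :
    ContDiff ℝ k (partialDeriv i u) :=
  (hu.fderiv_right le_rfl).clm_apply contDiff_const

theorem partialDeriv_comm (hu : ContDiff ℝ 2 u) (i j : Fin n) (x : Euc n) :
    partialDeriv i (partialDeriv j u) x = partialDeriv j (partialDeriv i u) x := by
  have hdiff : DifferentiableAt ℝ (fderiv ℝ u) x :=
    (hu.fderiv_right (m := 1) le_rfl).differentiable one_ne_zero x
  have hsnd (k l : Fin n) : partialDeriv k (partialDeriv l u) x =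
      fderiv ℝ (fderiv ℝ u) x (EuclideanSpace.single k 1) (EuclideanSpace.single l 1) := by
    change fderiv ℝ (fun y ↦ fderiv ℝ u y (EuclideanSpace.single l 1)) x _ = _
    simp [fderiv_clm_apply hdiff (differentiableAt_const _)]
  rw [hsnd, hsnd]
  exact hu.contDiffAt.isSymmSndFDerivAt (by simp) _ _

theorem laplacian_eq_sum_partialDeriv (hu : ContDiff ℝ 2 u) (x : Euc n) :
    Δ u x = ∑ i, partialDeriv i (partialDeriv i u) x := by
  rw [laplacian_eq_sum_fderiv_fderiv (EuclideanSpace.basisFun (Fin n) ℝ) hu]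
  simp only [fderiv_basisFun]

theorem sum_partialDeriv_sq (u : Euc n → ℝ) (x : Euc n) :
    ∑ i, partialDeriv i u x ^ 2 = ‖fderiv ℝ u x‖ ^ 2 := by
  simp_rw [← fderiv_basisFun, sq, sum_fderiv_mul_fderiv_eq, ← toDual_gradient,
    InnerProductSpace.toDual_apply_apply, real_inner_self_eq_norm_mul_norm,
    LinearIsometryEquiv.norm_map]

theorem inv_conformalMetric (u : Euc n → ℝ) (x : Euc n) :
    (conformalMetric u x)⁻¹ = Real.exp (-(2 * u x)) • (1 : Matrix (Fin n) (Fin n) ℝ) := by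
  refine Matrix.inv_eq_right_inv ?_
  rw [conformalMetric, smul_mul_smul_comm, ← Real.exp_add, add_neg_cancel, Real.exp_zero, one_smul,
    mul_one]

theorem partialDeriv_conformalMetric (hu : Differentiable ℝ u) (i j l : Fin n) (x : Euc n) :
    partialDeriv i (fun y ↦ conformalMetric u y j l) x =
      (if j = l then 1 else 0) * (2 * Real.exp (2 * u x) * partialDeriv i u x) := by
  by_cases h : j = l
  · simp only [conformalMetric, Matrix.smul_apply, Matrix.one_apply, h, if_true, smul_eq_mul,
      mul_one, partialDeriv]
    rw [fderiv_exp ((hu x).const_mul 2), fderiv_const_mul (hu x), smul_apply, smul_apply,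
      smul_eq_mul, smul_eq_mul]
    ring
  · simp [h, partialDeriv, conformalMetric]

theorem christoffel_conformalMetric (hu : Differentiable ℝ u) (k i j : Fin n) (x : Euc n) :
    christoffel (conformalMetric u) k i j x =
      (if j = k then 1 else 0) * partialDeriv i u x + (if i = k then 1 else 0) * partialDeriv j u x
        - (if i = j then 1 else 0) * partialDeriv k u x := by
  have hexp : Real.exp (-(2 * u x)) * Real.exp (2 * u x) = 1 := by
    rw [← Real.exp_add, neg_add_cancel, Real.exp_zero]
  simp_rw [christoffel, inv_conformalMetric, partialDeriv_conformalMetric hu, Matrix.smul_apply,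
    Matrix.one_apply, smul_eq_mul]
  rw [Finset.sum_eq_single k (fun l _ hl ↦ by simp [Ne.symm hl]) (by simp), if_pos rfl]
  linear_combination ((if j = k then 1 else 0) * partialDeriv i u x +
    (if i = k then 1 else 0) * partialDeriv j u x
      - (if i = j then 1 else 0) * partialDeriv k u x) * hexp

theorem partialDeriv_christoffel_conformalMetric (hu : ContDiff ℝ 2 u) (l k i j : Fin n)
    (x : Euc n) :
    partialDeriv l (christoffel (conformalMetric u) k i j) x =
      (if j = k then 1 else 0) * partialDeriv l (partialDeriv i u) x
        + (if i = k then 1 else 0) * partialDeriv l (partialDeriv j u) x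
        - (if i = j then 1 else 0) * partialDeriv l (partialDeriv k u) x := by
  have hd (i : Fin n) : HasFDerivAt (partialDeriv i u) (fderiv ℝ (partialDeriv i u) x) x :=
    ((contDiff_partialDeriv (k := 1) hu i).differentiable one_ne_zero x).hasFDerivAt
  have hΓ : HasFDerivAt (christoffel (conformalMetric u) k i j) _ x :=
    ((((hd i).const_mul (if j = k then (1 : ℝ) else 0)).add
      ((hd j).const_mul (if i = k then (1 : ℝ) else 0))).sub
      ((hd k).const_mul (if i = j then (1 : ℝ) else 0))).congr_of_eventuallyEq
    (.of_forall (christoffel_conformalMetric (hu.differentiable two_ne_zero) k i j))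
  rw [partialDeriv, hΓ.fderiv]
  rfl

theorem sum_christoffel_conformalMetric (hu : Differentiable ℝ u) (l : Fin n) (x : Euc n) :
    ∑ k, christoffel (conformalMetric u) k k l x = n * partialDeriv l u x := by
  simp [christoffel_conformalMetric hu, Finset.sum_add_distrib]

theorem sum_christoffel_mul_christoffel_conformalMetric (hu : Differentiable ℝ u) (i j : Fin n)
    (x : Euc n) :
    ∑ k, ∑ l, christoffel (conformalMetric u) k j l x * christoffel (conformalMetric u) l i k x =
      (n + 2) * (partialDeriv i u x * partialDeriv j u x)
        - 2 * (if i = j then 1 else 0) * ‖fderiv ℝ u x‖ ^ 2 := by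
  simp only [christoffel_conformalMetric hu, ← sum_partialDeriv_sq]
  simp only [ite_mul, one_mul, zero_mul, mul_sub, mul_add, mul_ite, sub_mul, add_mul, mul_zero,
    Finset.sum_sub_distrib, Finset.sum_add_distrib, Finset.sum_ite_eq, Finset.mem_univ, if_true,
    add_sub_cancel_right, Finset.sum_ite_irrel, Finset.sum_ite_eq', Finset.sum_const_zero,
    Finset.sum_const, Finset.card_univ, Fintype.card_fin, nsmul_eq_mul, mul_one]
  rcases eq_or_ne i j with rfl | hij
  · simp [sq]
    ring
  · rw [if_neg hij, if_neg hij.symm]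
    ring

theorem ricciTensor_conformalMetric (hu : ContDiff ℝ 2 u) (i j : Fin n) (x : Euc n) :
    ricciTensor (conformalMetric u) i j x =
      -(n - 2) * (partialDeriv i (partialDeriv j u) x - partialDeriv i u x * partialDeriv j u x)
        - (if i = j then 1 else 0) * (Δ u x + (n - 2) * ‖fderiv ℝ u x‖ ^ 2) := by
  have hu' : Differentiable ℝ u := hu.differentiable two_ne_zero
  have hΓ' : ∑ k, (partialDeriv k (christoffel (conformalMetric u) k i j) x -
      partialDeriv j (christoffel (conformalMetric u) k i k) x) =
      -(n - 2) * partialDeriv i (partialDeriv j u) x - (if i = j then 1 else 0) * Δ u x := by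
    simp_rw [partialDeriv_christoffel_conformalMetric hu, laplacian_eq_sum_partialDeriv hu]
    simp [Finset.sum_add_distrib, Finset.sum_sub_distrib, partialDeriv_comm hu j i]
    ring
  have hΓΓ : ∑ k, ∑ l, christoffel (conformalMetric u) k k l x *
      christoffel (conformalMetric u) l i j x = 2 * n * (partialDeriv i u x * partialDeriv j u x)
        - n * (if i = j then 1 else 0) * ‖fderiv ℝ u x‖ ^ 2 := by
    rw [Finset.sum_comm]
    simp_rw [← Finset.sum_mul, sum_christoffel_conformalMetric hu', christoffel_conformalMetric hu',
      ← sum_partialDeriv_sq]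
    simp only [ite_mul, one_mul, zero_mul, mul_sub, mul_add, mul_ite, mul_zero,
      Finset.sum_sub_distrib, Finset.sum_add_distrib, Finset.sum_ite_eq, Finset.mem_univ, if_true,
      Finset.sum_ite_irrel, Finset.sum_const_zero, mul_one]
    rcases eq_or_ne i j with rfl | hij
    · simp [sq, Finset.mul_sum, mul_assoc]
      ring
    · simp [hij]
      ring
  rw [ricciTensor, hΓ']
  simp_rw [Finset.sum_sub_distrib, hΓΓ, sum_christoffel_mul_christoffel_conformalMetric hu']
  ring

theorem scalarCurvature_conformalMetric (hu : ContDiff ℝ 2 u) (x : Euc n) :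
    scalarCurvature (conformalMetric u) x = -Real.exp (-(2 * u x)) *
      (2 * (n - 1) * Δ u x + (n - 1) * (n - 2) * ‖fderiv ℝ u x‖ ^ 2) := by
  have htrace : scalarCurvature (conformalMetric u) x =
      Real.exp (-(2 * u x)) * ∑ i, ricciTensor (conformalMetric u) i i x := by
    simp [scalarCurvature, inv_conformalMetric, Finset.mul_sum, Matrix.one_apply]
  simp_rw [htrace, ricciTensor_conformalMetric hu, if_true, one_mul, Finset.sum_sub_distrib,
    ← Finset.mul_sum, Finset.sum_sub_distrib, ← sq, sum_partialDeriv_sq,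
    ← laplacian_eq_sum_partialDeriv hu, Finset.sum_const, Finset.card_univ, Fintype.card_fin,
    nsmul_eq_mul]
  ring

theorem norm_fderiv_sq_le_neg_laplacian_of_scalarCurvature_nonneg (hn : 2 ≤ n)
    (hu : ContDiff ℝ 2 u) {x : Euc n} (hx : 0 ≤ scalarCurvature (conformalMetric u) x) :
    ((n : ℝ) - 2) / 2 * ‖fderiv ℝ u x‖ ^ 2 ≤ -Δ u x := by
  have hn' : (2 : ℝ) ≤ n := by exact_mod_cast hn
  rw [scalarCurvature_conformalMetric hu, neg_mul, neg_nonneg] at hx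
  have hfactor : (2 * ((n : ℝ) - 1)) * (Δ u x + ((n : ℝ) - 2) / 2 * ‖fderiv ℝ u x‖ ^ 2) ≤ 0 := by
    linarith [nonpos_of_mul_nonpos_right hx (Real.exp_pos _)]
  linarith [nonpos_of_mul_nonpos_right hfactor (by linarith)]

end Curvature

section EventualComparison

variable {f g f' g' : ℝ → ℝ}

theorem exists_eventually_sub_le_of_deriv_le (hf : ∀ᶠ r in atTop, HasDerivAt f (f' r) r)
    (hg : ∀ᶠ r in atTop, HasDerivAt g (g' r) r) (hle : ∀ᶠ r in atTop, g' r ≤ f' r) :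
    ∃ C, ∀ᶠ r in atTop, g r - C ≤ f r := by
  obtain ⟨R, hR⟩ := eventually_atTop.1 (hf.and (hg.and hle))
  have hderiv (x) (hx : x ∈ Ici R) : HasDerivAt (fun x ↦ f x - g x) (f' x - g' x) x :=
    (hR x hx).1.sub (hR x hx).2.1
  have hmono : MonotoneOn (fun x ↦ f x - g x) (Ici R) := by
    refine monotoneOn_of_hasDerivWithinAt_nonneg (convex_Ici R)
      (fun x hx ↦ (hderiv x hx).continuousAt.continuousWithinAt)
      (fun x hx ↦ (hderiv x (interior_subset hx)).hasDerivWithinAt) fun x hx ↦ ?_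
    exact sub_nonneg.2 (hR x (interior_subset hx)).2.2
  refine ⟨g R - f R, (eventually_ge_atTop R).mono fun r hr ↦ ?_⟩
  linarith [hmono self_mem_Ici hr hr]

theorem eventually_lt_div_of_eventually_lt_deriv_div {L : ℝ}
    (hf : ∀ᶠ r in atTop, HasDerivAt f (f' r) r) (hg : ∀ᶠ r in atTop, HasDerivAt g (g' r) r)
    (hg' : ∀ᶠ r in atTop, 0 < g' r) (hgt : Tendsto g atTop atTop)
    (hlt : ∀ a < L, ∀ᶠ r in atTop, a < f' r / g' r) {a : ℝ} (ha : a < L) :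
    ∀ᶠ r in atTop, a < f r / g r := by
  obtain ⟨b, hab, hbL⟩ := exists_between ha
  obtain ⟨C, hC⟩ := exists_eventually_sub_le_of_deriv_le (g := fun r ↦ b * g r) hf
    (hg.mono fun r hr ↦ hr.const_mul b) <| by
      filter_upwards [hlt b hbL, hg'] with r hr hr'
      exact ((lt_div_iff₀ hr').1 hr).le
  filter_upwards [hC, hgt.eventually_gt_atTop 0, hgt.eventually_gt_atTop (C / (b - a))]
    with r hle hpos hgC
  rw [div_lt_iff₀ (sub_pos.2 hab)] at hgC
  rw [lt_div_iff₀ hpos]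
  linarith

theorem tendsto_div_of_tendsto_deriv_div {L : ℝ} (hf : ∀ᶠ r in atTop, HasDerivAt f (f' r) r)
    (hg : ∀ᶠ r in atTop, HasDerivAt g (g' r) r) (hg' : ∀ᶠ r in atTop, 0 < g' r)
    (hgt : Tendsto g atTop atTop) (hL : Tendsto (fun r ↦ f' r / g' r) atTop (𝓝 L)) :
    Tendsto (fun r ↦ f r / g r) atTop (𝓝 L) := by
  refine tendsto_order.2 ⟨fun a ha ↦ eventually_lt_div_of_eventually_lt_deriv_div hf hg hg' hgt
    (fun b hb ↦ hL.eventually_const_lt hb) ha, fun a ha ↦ ?_⟩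
  have hneg : Tendsto (fun r ↦ -f' r / g' r) atTop (𝓝 (-L)) := by simpa only [neg_div] using hL.neg
  have hlt := eventually_lt_div_of_eventually_lt_deriv_div (hf.mono fun r hr ↦ hr.fun_neg) hg hg'
    hgt (fun b hb ↦ hneg.eventually_const_lt hb) (neg_lt_neg ha)
  exact hlt.mono fun r hr ↦ by rwa [neg_div, neg_lt_neg_iff] at hr

end EventualComparison

section RadialPoisson

/-- `p` is the derivative of a radial solution of `-Δ v = w` in dimension `N + 1`: the equation
`(r ^ N * v')' = -r ^ N * w`, integrated from the origin. -/
structure IsRadialFlux (N : ℕ) (p w : ℝ → ℝ) : Prop where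
  continuous_source : Continuous w
  pow_mul_eq : ∀ r > 0, r ^ N * p r = -∫ s in (0 : ℝ)..r, s ^ N * w s

/-- `f` is eventually bounded away from zero, with a constant sign, at infinity. For a radial
function this is what a nonzero polynomial part would force. -/
def EventuallyAwayFromZero (f : ℝ → ℝ) : Prop :=
  ∃ ε > 0, (∀ᶠ r in atTop, ε ≤ f r) ∨ ∀ᶠ r in atTop, f r ≤ -ε

variable {N : ℕ} {v p w : ℝ → ℝ}

theorem eq_zero_of_tendsto_of_not_eventuallyAwayFromZero {ℓ : ℝ} (hv : Tendsto v atTop (𝓝 ℓ))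
    (hnot : ¬ EventuallyAwayFromZero v) : ℓ = 0 := by
  by_contra hℓ
  refine hnot ?_
  rcases lt_or_gt_of_ne hℓ with hneg | hpos
  · exact ⟨-ℓ / 2, by linarith, .inr <|
      (hv.eventually_lt_const (by linarith : ℓ < ℓ / 2)).mono fun r hr ↦ by linarith⟩
  · exact ⟨ℓ / 2, by linarith, .inl <|
      (hv.eventually_const_lt (by linarith : ℓ / 2 < ℓ)).mono fun r hr ↦ hr.le⟩

theorem hasDerivAt_integral_pow_mul (hw : Continuous w) (N : ℕ) (r : ℝ) :
    HasDerivAt (fun r ↦ ∫ s in (0 : ℝ)..r, s ^ N * w s) (r ^ N * w r) r :=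
  (((continuous_id.pow N).mul hw).integral_hasStrictDerivAt 0 r).hasDerivAt

namespace IsRadialFlux

theorem neg (hp : IsRadialFlux N p w) : IsRadialFlux N (-p) (-w) where
  continuous_source := hp.continuous_source.neg
  pow_mul_eq r hr := by
    simp [hp.pow_mul_eq r hr]

theorem hasDerivAt (hp : IsRadialFlux N p w) {r : ℝ} (hr : 0 < r) :
    HasDerivAt p (-w r - N * p r / r) r := by
  have hquot : HasDerivAt (fun r ↦ -(∫ s in (0 : ℝ)..r, s ^ N * w s) / r ^ N) _ r :=
    (hasDerivAt_integral_pow_mul hp.continuous_source N r).fun_neg.fun_div (hasDerivAt_pow N r)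
      (by positivity)
  have heq : p =ᶠ[𝓝 r] fun r ↦ -(∫ s in (0 : ℝ)..r, s ^ N * w s) / r ^ N := by
    filter_upwards [lt_mem_nhds hr] with s hs
    rw [← hp.pow_mul_eq s hs, mul_div_cancel_left₀ _ (by positivity)]
  refine (hquot.congr_of_eventuallyEq heq).congr_deriv ?_
  rw [← hp.pow_mul_eq r hr]
  cases N with
  | zero => simp
  | succ N =>
    rw [Nat.add_sub_cancel]
    field_simp
    ring

theorem eventually_le_neg_mul (hp : IsRadialFlux N p w) {ε : ℝ} (hε : 0 < ε)
    (hw : ∀ᶠ r in atTop, ε ≤ w r) : ∀ᶠ r in atTop, p r ≤ -(ε / (2 * (N + 1)) * r) := by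
  have hpow (r : ℝ) : HasDerivAt (fun r : ℝ ↦ ε / (N + 1) * r ^ (N + 1)) (ε * r ^ N) r := by
    refine ((hasDerivAt_pow (N + 1) r).const_mul (ε / (N + 1))).congr_deriv ?_
    push_cast [Nat.add_sub_cancel]
    field_simp
  obtain ⟨C, hC⟩ := exists_eventually_sub_le_of_deriv_le
    (.of_forall (hasDerivAt_integral_pow_mul hp.continuous_source N)) (.of_forall hpow) <| by
      filter_upwards [hw, eventually_gt_atTop 0] with r hr hr0
      rw [mul_comm]
      gcongr
  have hlim : Tendsto (fun r : ℝ ↦ ε / (2 * (N + 1)) * r ^ (N + 1)) atTop atTop :=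
    (tendsto_pow_atTop N.succ_ne_zero).const_mul_atTop (by positivity)
  filter_upwards [hC, hlim.eventually_gt_atTop C, eventually_gt_atTop 0] with r hle hgt hr
  refine le_of_mul_le_mul_left ?_ (pow_pos hr N)
  have htwice : ε / (N + 1) * r ^ (N + 1) = 2 * (ε / (2 * (N + 1)) * r ^ (N + 1)) := by field_simp
  have hmul : r ^ N * -(ε / (2 * (N + 1)) * r) = -(ε / (2 * (N + 1)) * r ^ (N + 1)) := by ring
  rw [hp.pow_mul_eq r hr, hmul]
  linarith

theorem eventually_le_neg_of_source_ge (hp : IsRadialFlux N p w) (hv : ∀ r, HasDerivAt v (p r) r)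
    {ε : ℝ} (hε : 0 < ε) (hw : ∀ᶠ r in atTop, ε ≤ w r) (a : ℝ) : ∀ᶠ r in atTop, v r ≤ -a := by
  obtain ⟨C, hC⟩ := exists_eventually_sub_le_of_deriv_le (f := fun r ↦ -v r)
    (g := fun r ↦ ε / (2 * (N + 1)) * (r ^ 2 / 2)) (.of_forall fun r ↦ (hv r).fun_neg)
    (.of_forall fun r ↦ ((hasDerivAt_pow 2 r).div_const 2).const_mul _) <| by
      filter_upwards [hp.eventually_le_neg_mul hε hw] with r hr
      simpa using neg_le_neg hr
  have hlim : Tendsto (fun r : ℝ ↦ ε / (2 * (N + 1)) * (r ^ 2 / 2)) atTop atTop :=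
    ((tendsto_pow_atTop two_ne_zero).atTop_div_const two_pos).const_mul_atTop (by positivity)
  filter_upwards [hC, hlim.eventually_gt_atTop (C + a)] with r hle hgt
  linarith

theorem eventuallyAwayFromZero (hp : IsRadialFlux N p w) (hv : ∀ r, HasDerivAt v (p r) r)
    (hw : EventuallyAwayFromZero w) : EventuallyAwayFromZero v := by
  obtain ⟨ε, hε, hw | hw⟩ := hw
  · exact ⟨1, one_pos, .inr (hp.eventually_le_neg_of_source_ge hv hε hw 1)⟩
  · have hneg := hp.neg.eventually_le_neg_of_source_ge (fun r ↦ (hv r).neg) hε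
      (hw.mono fun r hr ↦ le_neg_of_le_neg hr) 1
    exact ⟨1, one_pos, .inl (hneg.mono fun r hr ↦ neg_le_neg_iff.1 hr)⟩

/-- Otherwise `p` would tend to `-∞`, and then `(1 / p)' = w / p ^ 2 + N / (r * p)` would stay above
`c / 2`, against `1 / p < 0`. -/
theorem not_eventuallyAwayFromZero_of_riccati (hp : IsRadialFlux N p w) {c : ℝ} (hc : 0 < c)
    (hw : ∀ᶠ r in atTop, c * p r ^ 2 ≤ w r) : ¬ EventuallyAwayFromZero w := by
  rintro ⟨ε, hε, hge | hle⟩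
  swap
  · obtain ⟨r, hr, hr'⟩ := (hle.and hw).exists
    have : 0 ≤ c * p r ^ 2 := by positivity
    linarith
  have hp_le := hp.eventually_le_neg_mul hε hge
  have hp_neg : ∀ᶠ r in atTop, p r < 0 := by
    filter_upwards [hp_le, eventually_gt_atTop 0] with r hr hr0
    exact hr.trans_lt (neg_neg_of_pos (by positivity))
  have hrp : Tendsto (fun r ↦ r * p r) atTop atBot := by
    refine tendsto_id.atTop_mul_atBot₀ (tendsto_atBot_mono' _ hp_le ?_)
    exact tendsto_neg_atTop_atBot.comp (tendsto_id.const_mul_atTop (by positivity))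
  have hsmall : ∀ᶠ r in atTop, -(c / 2) < N / (r * p r) :=
    (hrp.const_div_atBot (N : ℝ)).eventually_const_lt (by linarith)
  obtain ⟨C, hC⟩ := exists_eventually_sub_le_of_deriv_le (f := fun r ↦ (p r)⁻¹)
    (f' := fun r ↦ -(-w r - N * p r / r) / p r ^ 2) (g := fun r ↦ c / 2 * r) (g' := fun _ ↦ c / 2)
    (by
      filter_upwards [hp_neg, eventually_gt_atTop 0] with r hneg hr
      exact (hp.hasDerivAt hr).inv hneg.ne)
    (.of_forall fun r ↦ by simpa using (hasDerivAt_id r).const_mul (c / 2))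
    (by
      filter_upwards [hp_neg, hsmall, hw, eventually_gt_atTop 0] with r hneg hN hr hr0
      have hquot : c ≤ w r / p r ^ 2 := (le_div_iff₀ (sq_pos_of_neg hneg)).2 hr
      have hsplit : -(-w r - N * p r / r) / p r ^ 2 = w r / p r ^ 2 + N / (r * p r) := by
        field_simp [hneg.ne]
        ring
      linarith)
  obtain ⟨r, hle, hneg, hgt⟩ := (hC.and (hp_neg.and
    ((tendsto_id.const_mul_atTop (half_pos hc)).eventually_gt_atTop C))).exists
  have : (p r)⁻¹ < 0 := inv_lt_zero.2 hneg
  simp only [id] at hgt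
  linarith

theorem tendsto_pow_mul (hp : IsRadialFlux N p w) {a : ℕ} (ha : a < N) {b : ℝ}
    (hw : Tendsto (fun r ↦ r ^ (a + 1) * w r) atTop (𝓝 b)) :
    Tendsto (fun r ↦ r ^ a * p r) atTop (𝓝 (-(b / (N - a)))) := by
  obtain ⟨k, rfl⟩ := Nat.exists_eq_add_of_lt ha
  have hcast : ((a + k + 1 : ℕ) : ℝ) - a = (k + 1 : ℕ) := by push_cast; ring
  have hquot := tendsto_div_of_tendsto_deriv_div (L := b / (k + 1 : ℕ))
    (.of_forall (hasDerivAt_integral_pow_mul hp.continuous_source (a + k + 1)))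
    (.of_forall fun r : ℝ ↦ hasDerivAt_pow (k + 1) r)
    (by filter_upwards [eventually_gt_atTop 0] with r hr; positivity)
    (tendsto_pow_atTop k.succ_ne_zero) <| by
      refine (hw.div_const _).congr' ?_
      filter_upwards [eventually_gt_atTop 0] with r hr
      rw [Nat.add_sub_cancel]
      field_simp
      ring
  rw [hcast]
  refine hquot.neg.congr' ?_
  filter_upwards [eventually_gt_atTop 0] with r hr
  rw [← neg_div, ← hp.pow_mul_eq r hr, add_assoc, pow_add, mul_right_comm,
    mul_div_cancel_right₀ _ (by positivity)]

end IsRadialFlux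

theorem integrableOn_Ioi_of_tendsto_pow_mul (hp : Continuous p) {a : ℕ} (ha : 1 ≤ a) {d : ℝ}
    (hd : Tendsto (fun r ↦ r ^ (a + 1) * p r) atTop (𝓝 d)) : IntegrableOn p (Ioi 1) := by
  have hO : p =O[atTop] fun r : ℝ ↦ r ^ (-(a + 1) : ℝ) := by
    refine ((hd.isBigO_one ℝ).mul
      (Asymptotics.isBigO_refl (fun r : ℝ ↦ r ^ (-(a + 1) : ℝ)) atTop)).congr' ?_
      (.of_forall fun r ↦ one_mul _)
    filter_upwards [eventually_gt_atTop 0] with r hr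
    rw [Real.rpow_neg hr.le, ← Nat.cast_add_one, Real.rpow_natCast]
    field_simp
  have ha' : (-(a + 1) : ℝ) < -1 := by
    have : (1 : ℝ) ≤ a := by exact_mod_cast ha
    linarith
  exact ((hp.locallyIntegrable.locallyIntegrableOn _).integrableOn_of_isBigO_atTop hO
    (integrableAtFilter_rpow_atTop_iff.2 ha')).mono_set Ioi_subset_Ici_self

theorem tendsto_pow_mul_of_deriv (hv : ∀ r, HasDerivAt v (p r) r) (hp : Continuous p) {a : ℕ}
    (ha : 1 ≤ a) (hnot : ¬ EventuallyAwayFromZero v) {d : ℝ}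
    (hd : Tendsto (fun r ↦ r ^ (a + 1) * p r) atTop (𝓝 (-d))) :
    Tendsto (fun r ↦ r ^ a * v r) atTop (𝓝 (d / a)) := by
  have hlim := tendsto_limUnder_of_hasDerivAt_of_integrableOn_Ioi (fun r _ ↦ hv r)
    (integrableOn_Ioi_of_tendsto_pow_mul hp ha hd)
  rw [eq_zero_of_tendsto_of_not_eventuallyAwayFromZero hlim hnot] at hlim
  have hquot := HasDerivAt.lhopital_zero_atTop (l := 𝓝 (d / a)) (.of_forall hv)
    ((eventually_gt_atTop (0 : ℝ)).mono fun r hr ↦ (hasDerivAt_pow a r).fun_inv (by positivity))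
    (by
      filter_upwards [eventually_gt_atTop 0] with r hr
      have : 0 < (a : ℝ) * r ^ (a - 1) := by positivity
      exact div_ne_zero (neg_ne_zero.2 this.ne') (by positivity))
    hlim (tendsto_pow_atTop (by omega)).inv_tendsto_atTop <| by
      refine ((hd.neg.div_const (a : ℝ)).congr' ?_).trans_eq (by rw [neg_neg])
      filter_upwards [eventually_gt_atTop 0] with r hr
      obtain ⟨k, rfl⟩ := Nat.exists_eq_add_of_le' ha
      rw [Nat.add_sub_cancel]
      field_simp
      ring
  simpa only [div_inv_eq_mul, mul_comm] using hquot

section System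

variable {m : ℕ} {v p : ℕ → ℝ → ℝ} {I c : ℝ}

theorem not_eventuallyAwayFromZero_of_radial_system (hv : ∀ k r, HasDerivAt (v k) (p k r) r)
    (hp : ∀ k, IsRadialFlux N (p k) (v (k + 1))) (hc : 0 < c)
    (hR : ∀ᶠ r in atTop, c * p 0 r ^ 2 ≤ v 1 r) (k : ℕ) :
    ¬ EventuallyAwayFromZero (v (k + 1)) := by
  induction k with
  | zero => exact (hp 0).not_eventuallyAwayFromZero_of_riccati hc hR
  | succ k ih => exact fun haway ↦ ih ((hp (k + 1)).eventuallyAwayFromZero (hv (k + 1)) haway)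

theorem tendsto_pow_mul_of_radial_system (hv : ∀ k r, HasDerivAt (v k) (p k r) r)
    (hpc : ∀ k, Continuous (p k)) (hp : ∀ k, IsRadialFlux (2 * m - 1) (p k) (v (k + 1)))
    (hI : Tendsto (fun r ↦ ∫ s in (0 : ℝ)..r, s ^ (2 * m - 1) * v m s) atTop (𝓝 I)) (hc : 0 < c)
    (hR : ∀ᶠ r in atTop, c * p 0 r ^ 2 ≤ v 1 r) (j : ℕ) {k : ℕ} (hkj : k + j + 1 = m) :
    Tendsto (fun r ↦ r ^ (2 * k + 1) * p k r) atTop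
      (𝓝 (-(I / (4 ^ j * j.factorial * (m - 1).descFactorial j)))) := by
  induction j generalizing k with
  | zero =>
    subst hkj
    simp only [add_zero, pow_zero, Nat.factorial_zero, Nat.cast_one, mul_one,
      Nat.descFactorial_zero, div_one]
    refine hI.neg.congr' ?_
    filter_upwards [eventually_gt_atTop 0] with r hr
    rw [← (hp k).pow_mul_eq r hr]
    rfl
  | succ j ih =>
    have hsource := tendsto_pow_mul_of_deriv (hv (k + 1)) (hpc (k + 1)) (a := 2 * (k + 1))
      (by omega) (not_eventuallyAwayFromZero_of_radial_system hv hp hc hR k) (ih (by omega))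
    have hflux := (hp k).tendsto_pow_mul (a := 2 * k + 1) (by omega) hsource
    convert hflux using 3
    have hN : ((2 * m - 1 : ℕ) : ℝ) - (2 * k + 1 : ℕ) = 2 * (j + 1) := by
      rw [← hkj, sub_eq_iff_eq_add]
      norm_cast
      omega
    have hfactor : m - 1 - j = k + 1 := by omega
    rw [hN, Nat.descFactorial_succ, Nat.factorial_succ, hfactor, div_div, div_div]
    push_cast
    ring

theorem tendsto_mul_of_radial_system (hm : 1 ≤ m) (hv : ∀ k r, HasDerivAt (v k) (p k r) r)
    (hpc : ∀ k, Continuous (p k)) (hp : ∀ k, IsRadialFlux (2 * m - 1) (p k) (v (k + 1)))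
    (hI : Tendsto (fun r ↦ ∫ s in (0 : ℝ)..r, s ^ (2 * m - 1) * v m s) atTop (𝓝 I)) (hc : 0 < c)
    (hR : ∀ᶠ r in atTop, c * p 0 r ^ 2 ≤ v 1 r) :
    Tendsto (fun r ↦ r * p 0 r) atTop (𝓝 (-(I / (2 ^ (m - 1) * (m - 1).factorial) ^ 2))) := by
  have hlim := tendsto_pow_mul_of_radial_system hv hpc hp hI hc hR (m - 1) (k := 0) (by omega)
  simp only [mul_zero, zero_add, pow_one, Nat.descFactorial_self] at hlim
  convert hlim using 3
  rw [mul_pow, ← pow_mul, mul_comm (m - 1), pow_mul]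
  ring

end System

end RadialPoisson

theorem hasDerivAt_setIntegral_of_isCompact {X : Type*} [TopologicalSpace X] [MeasurableSpace X]
    [OpensMeasurableSpace X] {μ : Measure X} [IsFiniteMeasureOnCompacts μ] {F F' : ℝ → X → ℝ}
    (hF : Continuous F.uncurry) (hF' : Continuous F'.uncurry)
    (hd : ∀ r x, HasDerivAt (F · x) (F' r x) r) {K : Set X} (hK : IsCompact K)
    (hKm : MeasurableSet K) (r : ℝ) :
    HasDerivAt (fun r ↦ ∫ x in K, F r x ∂μ) (∫ x in K, F' r x ∂μ) r := by
  have hFr (s : ℝ) : Continuous (F s) := hF.comp (Continuous.prodMk_right s)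
  have hFr' : Continuous (F' r) := hF'.comp (Continuous.prodMk_right r)
  obtain ⟨M, hM⟩ := ((isCompact_closedBall r 1).prod hK).exists_bound_of_continuousOn
    hF'.continuousOn
  have hbound : ∀ᵐ x ∂μ.restrict K, ∀ s ∈ closedBall r 1, ‖F' s x‖ ≤ M :=
    (ae_restrict_iff' hKm).2 (.of_forall fun x hx s hs ↦ hM (s, x) ⟨hs, hx⟩)
  exact (hasDerivAt_integral_of_dominated_loc_of_deriv_le (bound := fun _ ↦ M)
    (closedBall_mem_nhds r one_pos) (.of_forall fun s ↦ (hFr s).aestronglyMeasurable)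
    ((hFr r).continuousOn.integrableOn_compact' hK hKm) hFr'.aestronglyMeasurable
    hbound (integrableOn_const hK.measure_ne_top) (.of_forall fun x s _ ↦ hd s x)).2

section SphereMean

variable {E : Type*} [NormedAddCommGroup E] [InnerProductSpace ℝ E] [FiniteDimensional ℝ E]
  [MeasurableSpace E] [BorelSpace E] {u v w : E → ℝ}

/-- The mean of `v` over the sphere of radius `r` centred at the origin, written as an average over
the unit sphere so that it makes sense for every real `r`. -/
noncomputable def sphereMean (v : E → ℝ) (r : ℝ) : ℝ :=
  ⨍ θ : sphere (0 : E) 1, v (r • (θ : E)) ∂(volume : Measure E).toSphere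

/-- The mean of the outward normal derivative of `v` over the sphere of radius `r` centred at the
origin. -/
noncomputable def sphereFlux (v : E → ℝ) (r : ℝ) : ℝ :=
  ⨍ θ : sphere (0 : E) 1, fderiv ℝ v (r • (θ : E)) θ ∂(volume : Measure E).toSphere

theorem sphereMean_const [Nontrivial E] (m r : ℝ) : sphereMean (fun _ : E ↦ m) r = m :=
  have : NeZero (volume : Measure E).toSphere := ⟨Measure.toSphere_ne_zero _⟩
  average_const _ m

theorem sphereMean_zero [Nontrivial E] (v : E → ℝ) : sphereMean v 0 = v 0 := by
  simpa [sphereMean] using sphereMean_const (E := E) (v 0) 0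

theorem sphereMean_neg (v : E → ℝ) (r : ℝ) : sphereMean (-v) r = -sphereMean v r :=
  average_neg _ _

theorem sphereMean_radial_mul (G : ℝ → ℝ) (v : E → ℝ) (r : ℝ) :
    sphereMean (fun x ↦ G (‖x‖ ^ 2) * v x) r = G (r ^ 2) * sphereMean v r := by
  simp [sphereMean, average, norm_smul, integral_const_mul]

theorem mul_sphereFlux (v : E → ℝ) (r : ℝ) :
    r * sphereFlux v r = sphereMean (fun x ↦ fderiv ℝ v x x) r := by
  simp [sphereMean, sphereFlux, average, integral_const_mul]

theorem integrable_toSphere {f : sphere (0 : E) 1 → ℝ} (hf : Continuous f) :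
    Integrable f (volume : Measure E).toSphere :=
  hf.integrable_of_hasCompactSupport (HasCompactSupport.of_compactSpace f)

theorem sphereMean_sub (hv : Continuous v) (hw : Continuous w) (r : ℝ) :
    sphereMean (fun x ↦ v x - w x) r = sphereMean v r - sphereMean w r := by
  have hint {f : E → ℝ} (hf : Continuous f) :
      Integrable (fun θ : sphere (0 : E) 1 ↦ f (r • (θ : E)))
        ((volume.toSphere univ)⁻¹ • volume.toSphere) :=
    (integrable_toSphere (by fun_prop)).to_average
  exact integral_sub (hint hv) (hint hw)

theorem continuous_sphereMean (hv : Continuous v) : Continuous (sphereMean v) := by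
  have hcont := continuous_parametric_integral_of_continuous
    (μ := (volume : Measure E).toSphere) (f := fun (r : ℝ) (θ : sphere (0 : E) 1) ↦ v (r • (θ : E)))
    (by unfold Function.uncurry; fun_prop) isCompact_univ
  rw [Measure.restrict_univ] at hcont
  simp only [funext fun r ↦ show sphereMean v r = _ from average_eq _ _]
  exact hcont.const_smul (_ : ℝ)

theorem continuous_sphereFlux (hv : ContDiff ℝ 1 v) : Continuous (sphereFlux v) := by
  have hcont := continuous_parametric_integral_of_continuous (μ := (volume : Measure E).toSphere)
    (f := fun (r : ℝ) (θ : sphere (0 : E) 1) ↦ fderiv ℝ v (r • (θ : E)) θ)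
    (by unfold Function.uncurry; fun_prop) isCompact_univ
  rw [Measure.restrict_univ] at hcont
  simp only [funext fun r ↦ show sphereFlux v r = _ from average_eq _ _]
  exact hcont.const_smul (_ : ℝ)

theorem hasDerivAt_sphereMean (hv : ContDiff ℝ 1 v) (r : ℝ) :
    HasDerivAt (sphereMean v) (sphereFlux v r) r := by
  have hvc := hv.continuous
  have hray (r : ℝ) (θ : sphere (0 : E) 1) :
      HasDerivAt (fun r : ℝ ↦ v (r • (θ : E))) (fderiv ℝ v (r • (θ : E)) θ) r := by
    have hsmul : HasDerivAt (fun r : ℝ ↦ r • (θ : E)) (θ : E) r := by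
      simpa using (hasDerivAt_id r).smul_const (θ : E)
    exact (hv.differentiable one_ne_zero _).hasFDerivAt.comp_hasDerivAt r hsmul
  have hderiv := hasDerivAt_setIntegral_of_isCompact (μ := (volume : Measure E).toSphere)
    (F := fun r θ ↦ v (r • (θ : E))) (by unfold Function.uncurry; fun_prop)
    (by unfold Function.uncurry; fun_prop) hray isCompact_univ .univ r
  simp only [Measure.restrict_univ] at hderiv
  rw [sphereFlux, average_eq, funext fun r ↦ show sphereMean v r = _ from average_eq _ _]
  exact hderiv.const_smul (_ : ℝ)

theorem average_toSphere_mono {f g : sphere (0 : E) 1 → ℝ} (hf : Continuous f)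
    (hg : Continuous g) (h : ∀ θ, f θ ≤ g θ) :
    ⨍ θ, f θ ∂(volume : Measure E).toSphere ≤ ⨍ θ, g θ ∂(volume : Measure E).toSphere :=
  integral_mono (integrable_toSphere hf).to_average (integrable_toSphere hg).to_average h

theorem sphereMean_mono (hv : Continuous v) (hw : Continuous w) {r : ℝ}
    (h : ∀ x, ‖x‖ = |r| → v x ≤ w x) : sphereMean v r ≤ sphereMean w r :=
  average_toSphere_mono (by fun_prop) (by fun_prop) fun θ ↦ h _ (by simp [norm_smul])

theorem sphereFlux_sq_le [Nontrivial E] (hv : ContDiff ℝ 1 v) (r : ℝ) :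
    sphereFlux v r ^ 2 ≤ sphereMean (fun x ↦ ‖fderiv ℝ v x‖ ^ 2) r := by
  have : NeZero (volume : Measure E).toSphere := ⟨Measure.toSphere_ne_zero _⟩
  have hcont : Continuous fun θ : sphere (0 : E) 1 ↦ fderiv ℝ v (r • (θ : E)) θ := by fun_prop
  have hnorm (θ : sphere (0 : E) 1) : ‖fderiv ℝ v (r • (θ : E)) θ‖ ≤ ‖fderiv ℝ v (r • (θ : E))‖ :=
    (fderiv ℝ v (r • (θ : E))).unit_le_opNorm _ (norm_eq_of_mem_sphere θ).le
  calc sphereFlux v r ^ 2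
      ≤ ⨍ θ : sphere (0 : E) 1, fderiv ℝ v (r • (θ : E)) θ ^ 2 ∂(volume : Measure E).toSphere :=
        (even_two.convexOn_pow (𝕜 := ℝ)).map_average_le (by fun_prop) isClosed_univ (by simp)
          (integrable_toSphere hcont) (integrable_toSphere (hcont.pow 2))
    _ ≤ sphereMean (fun x ↦ ‖fderiv ℝ v x‖ ^ 2) r :=
        average_toSphere_mono (hcont.pow 2) (by fun_prop) fun θ ↦
          sq_le_sq.2 ((hnorm θ).trans_eq (abs_norm _).symm)

theorem mul_sphereFlux_sq_le_of_norm_fderiv_sq_le [Nontrivial E] (hv : ContDiff ℝ 2 v) {c r : ℝ}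
    (hc : 0 ≤ c) (h : ∀ x, ‖x‖ = |r| → c * ‖fderiv ℝ v x‖ ^ 2 ≤ -Δ v x) :
    c * sphereFlux v r ^ 2 ≤ sphereMean (-Δ v) r := by
  have hv' := hv.continuous_fderiv two_ne_zero
  have hΔ : Continuous (-Δ v) := (contDiff_laplacian (n := 0) (by simpa using hv)).continuous.neg
  calc c * sphereFlux v r ^ 2
      ≤ c * sphereMean (fun x ↦ ‖fderiv ℝ v x‖ ^ 2) r := by
        gcongr; exact sphereFlux_sq_le (hv.of_le one_le_two) r
    _ = sphereMean (fun x ↦ c * ‖fderiv ℝ v x‖ ^ 2) r :=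
        (sphereMean_radial_mul (fun _ ↦ c) _ r).symm
    _ ≤ sphereMean (-Δ v) r := sphereMean_mono (by fun_prop) hΔ h

end SphereMean

section Polar

theorem integral_volumeIoiPow (k : ℕ) (f : ℝ → ℝ) :
    ∫ r : Ioi (0 : ℝ), f r ∂(Measure.volumeIoiPow k) = ∫ r in Ioi (0 : ℝ), r ^ k * f r := by
  rw [Measure.volumeIoiPow, integral_withDensity_eq_integral_toReal_smul (by fun_prop) (by simp),
    ← integral_subtype_comap measurableSet_Ioi fun r ↦ r ^ k * f r]
  refine integral_congr_ae (.of_forall fun r ↦ ?_)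
  simp only [ENNReal.toReal_ofReal (pow_nonneg r.2.out.le k), smul_eq_mul]

theorem integrable_volumeIoiPow {k : ℕ} {f : ℝ → ℝ} :
    Integrable (fun r : Ioi (0 : ℝ) ↦ f r) (Measure.volumeIoiPow k) ↔
      IntegrableOn (fun r ↦ r ^ k * f r) (Ioi 0) := by
  rw [integrableOn_iff_comap_subtypeVal measurableSet_Ioi, Measure.volumeIoiPow,
    integrable_withDensity_iff_integrable_smul' (by fun_prop) (by simp)]
  refine integrable_congr (.of_forall fun r ↦ ?_)
  simp only [ENNReal.toReal_ofReal (pow_nonneg r.2.out.le k), smul_eq_mul, Function.comp_apply]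

theorem setIntegral_Ioi_eq_intervalIntegral {f : ℝ → ℝ} {b : ℝ} (hb : 0 ≤ b)
    (h : ∀ s, b < s → f s = 0) : ∫ s in Ioi (0 : ℝ), f s = ∫ s in (0 : ℝ)..b, f s := by
  rw [intervalIntegral.integral_of_le hb]
  exact setIntegral_eq_of_subset_of_forall_sdiff_eq_zero measurableSet_Ioi Ioc_subset_Ioi_self
    fun s hs ↦ h s (not_le.1 fun hsb ↦ hs.2 ⟨hs.1, hsb⟩)

variable {E : Type*} [NormedAddCommGroup E] [InnerProductSpace ℝ E]

theorem comp_homeomorphUnitSphereProd (F : E → ℝ) (x : ({0}ᶜ : Set E)) :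
    F (((homeomorphUnitSphereProd E x).2 : ℝ) • ((homeomorphUnitSphereProd E x).1 : E)) = F x := by
  have hx : ‖(x : E)‖ ≠ 0 := norm_ne_zero_iff.2 x.2
  simp [smul_smul, hx]

variable [FiniteDimensional ℝ E] [MeasurableSpace E] [BorelSpace E] {F : E → ℝ}

theorem toSphere_real_univ_mul_sphereMean (F : E → ℝ) (r : ℝ) :
    (volume : Measure E).toSphere.real univ * sphereMean F r =
      ∫ θ : sphere (0 : E) 1, F (r • (θ : E)) ∂(volume : Measure E).toSphere :=
  measure_smul_average _ _

theorem integrable_polar (hF : Integrable F) :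
    Integrable (fun p : sphere (0 : E) 1 × Ioi (0 : ℝ) ↦ F ((p.2 : ℝ) • (p.1 : E)))
      ((volume : Measure E).toSphere.prod (Measure.volumeIoiPow (finrank ℝ E - 1))) := by
  rw [← (volume : Measure E).measurePreserving_homeomorphUnitSphereProd.integrable_comp_emb
    (Homeomorph.measurableEmbedding _)]
  refine (integrable_congr (.of_forall (comp_homeomorphUnitSphereProd F))).2 ?_
  exact (integrableOn_iff_comap_subtypeVal (measurableSet_singleton _).compl).1 hF.integrableOn

variable [Nontrivial E]

theorem toSphere_real_univ_pos : 0 < (volume : Measure E).toSphere.real univ := by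
  have : NeZero (volume : Measure E).toSphere := ⟨Measure.toSphere_ne_zero _⟩
  exact measureReal_univ_pos

theorem integrableOn_pow_mul_sphereMean (hF : Integrable F) :
    IntegrableOn (fun r ↦ r ^ (finrank ℝ E - 1) * sphereMean F r) (Ioi 0) := by
  refine integrable_volumeIoiPow.1 ?_
  have hint := (integrable_polar hF).integral_prod_right
  simp only [← toSphere_real_univ_mul_sphereMean] at hint
  exact (integrable_const_mul_iff toSphere_real_univ_pos.ne'.isUnit _).1 hint

theorem integral_eq_integral_pow_mul_sphereMean (hF : Integrable F) :
    ∫ x, F x = (volume : Measure E).toSphere.real univ *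
      ∫ r in Ioi (0 : ℝ), r ^ (finrank ℝ E - 1) * sphereMean F r := by
  calc ∫ x, F x
      = ∫ p : sphere (0 : E) 1 × Ioi (0 : ℝ), F ((p.2 : ℝ) • (p.1 : E))
          ∂((volume : Measure E).toSphere.prod (Measure.volumeIoiPow (finrank ℝ E - 1))) := by
        rw [← (volume : Measure E).measurePreserving_homeomorphUnitSphereProd.integral_comp
          (Homeomorph.measurableEmbedding _)]
        simp_rw [comp_homeomorphUnitSphereProd]
        rw [integral_subtype_comap (measurableSet_singleton _).compl F, restrict_compl_singleton]
    _ = ∫ r : Ioi (0 : ℝ), (volume : Measure E).toSphere.real univ * sphereMean F r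
          ∂(Measure.volumeIoiPow (finrank ℝ E - 1)) := by
        simp_rw [integral_prod_symm _ (integrable_polar hF), toSphere_real_univ_mul_sphereMean]
    _ = _ := by rw [integral_const_mul, integral_volumeIoiPow]

end Polar

section DivergenceTheorem

theorem eq_zero_of_forall_integral_comp_sq_mul_eq_zero {h : ℝ → ℝ} (hh : Continuous h) {b r : ℝ}
    (hr : r ∈ Ioo 0 b) (hint : ∀ ψ : ℝ → ℝ, Continuous ψ → (∀ t, b ^ 2 ≤ t → ψ t = 0) →
      ∫ s in (0 : ℝ)..b, 2 * s * ψ (s ^ 2) * h s = 0) : h r = 0 := by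
  by_contra hne
  have hb : 0 < b := hr.1.trans hr.2
  have hzero := hint (fun t ↦ max (b ^ 2 - t) 0 * h √t) (by fun_prop) fun t ht ↦ by
    rw [max_eq_right (by linarith), zero_mul]
  refine hzero.not_gt (intervalIntegral.integral_pos hb (by fun_prop) (fun s hs ↦ ?_)
    ⟨r, Ioo_subset_Icc_self hr, ?_⟩)
  · have hs0 : 0 ≤ s := hs.1.le
    rw [Real.sqrt_sq hs0, mul_assoc, mul_assoc (max _ _), ← sq]
    positivity
  · have hrb : 0 < b ^ 2 - r ^ 2 := sub_pos.2 (pow_lt_pow_left₀ hr.2 hr.1.le two_ne_zero)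
    have hr0 : 0 < r := hr.1
    rw [Real.sqrt_sq hr0.le, mul_assoc, mul_assoc (max _ _), ← sq, max_eq_left hrb.le]
    positivity

variable {E : Type*} [NormedAddCommGroup E] [InnerProductSpace ℝ E] [FiniteDimensional ℝ E]
  [MeasurableSpace E] [BorelSpace E] [Nontrivial E] {v : E → ℝ}

theorem integral_pow_mul_sphereMean_laplacian {Θ : ℝ → ℝ} (hΘ : ContDiff ℝ 1 Θ) {b : ℝ}
    (hb : 0 ≤ b) (hΘb : ∀ t, b ^ 2 ≤ t → Θ t = 0) (hΘb' : ∀ t, b ^ 2 ≤ t → deriv Θ t = 0)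
    (hv : ContDiff ℝ 2 v) :
    ∫ s in (0 : ℝ)..b, Θ (s ^ 2) * (s ^ (finrank ℝ E - 1) * sphereMean (Δ v) s) =
      -∫ s in (0 : ℝ)..b, 2 * s * deriv Θ (s ^ 2) * (s ^ (finrank ℝ E - 1) * sphereFlux v s) := by
  have hΔ : Continuous (Δ v) := (contDiff_laplacian (n := 0) (by simpa using hv)).continuous
  have hv' := hv.continuous_fderiv two_ne_zero
  have hpolar {G : ℝ → ℝ} (hG : Continuous G) (hGb : ∀ t, b ^ 2 ≤ t → G t = 0) {w : E → ℝ}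
      (hw : Continuous w) : ∫ x, G (‖x‖ ^ 2) * w x = (volume : Measure E).toSphere.real univ *
        ∫ s in (0 : ℝ)..b, G (s ^ 2) * (s ^ (finrank ℝ E - 1) * sphereMean w s) := by
    rw [integral_eq_integral_pow_mul_sphereMean
      ((by fun_prop : Continuous fun x ↦ G (‖x‖ ^ 2) * w x).integrable_of_hasCompactSupport
        (hasCompactSupport_comp_norm_sq hGb).mul_right)]
    simp_rw [sphereMean_radial_mul, mul_left_comm _ (G _)]
    rw [setIntegral_Ioi_eq_intervalIntegral hb fun s hs ↦ by
      rw [hGb _ (pow_le_pow_left₀ hb hs.le 2), zero_mul]]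
  have hgreen := integral_radial_mul_laplacian hΘ hΘb hv
  rw [hpolar hΘ.continuous hΘb hΔ,
    hpolar (G := fun t ↦ 2 * deriv Θ t) (by fun_prop) (fun t ht ↦ by rw [hΘb' t ht, mul_zero])
      (w := fun x ↦ fderiv ℝ v x x) (by fun_prop), ← mul_neg] at hgreen
  rw [mul_left_cancel₀ toSphere_real_univ_pos.ne' hgreen]
  simp_rw [← mul_sphereFlux]
  congr 2 with s
  ring

theorem pow_mul_sphereFlux (hv : ContDiff ℝ 2 v) {r : ℝ} (hr : 0 < r) :
    r ^ (finrank ℝ E - 1) * sphereFlux v r =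
      ∫ s in (0 : ℝ)..r, s ^ (finrank ℝ E - 1) * sphereMean (Δ v) s := by
  set N := finrank ℝ E - 1
  have hΔ : Continuous (sphereMean (Δ v)) :=
    continuous_sphereMean (contDiff_laplacian (n := 0) (by simpa using hv)).continuous
  have hflux := continuous_sphereFlux (hv.of_le one_le_two)
  have hprim := hasDerivAt_integral_pow_mul hΔ N
  refine (sub_eq_zero.1 (eq_zero_of_forall_integral_comp_sq_mul_eq_zero
    (h := fun r ↦ (∫ s in (0 : ℝ)..r, s ^ N * sphereMean (Δ v) s) - r ^ N * sphereFlux v r)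
    (by fun_prop) ⟨hr, lt_add_one r⟩ fun ψ hψ hψb ↦ ?_)).symm
  set b := r + 1
  have hΘ (t : ℝ) : HasDerivAt (fun t ↦ ∫ x in b ^ 2..t, ψ x) (ψ t) t :=
    (hψ.integral_hasStrictDerivAt _ t).hasDerivAt
  have hΘ_sq (s : ℝ) :
      HasDerivAt (fun s ↦ ∫ x in b ^ 2..s ^ 2, ψ x) (2 * s * ψ (s ^ 2)) s := by
    have hcomp := (hΘ (s ^ 2)).comp s (hasDerivAt_pow 2 s)
    exact hcomp.congr_deriv (by push_cast; ring)
  have hΘb (t : ℝ) (ht : b ^ 2 ≤ t) : ∫ x in b ^ 2..t, ψ x = 0 := by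
    refine (intervalIntegral.integral_congr fun x hx ↦ ?_).trans intervalIntegral.integral_zero
    exact hψb x ((uIcc_of_le ht ▸ hx).1)
  have hgreen := integral_pow_mul_sphereMean_laplacian (b := b)
    (contDiff_one_iff_deriv.2 ⟨fun t ↦ (hΘ t).differentiableAt, by
      rwa [funext fun t ↦ (hΘ t).deriv]⟩)
    (by positivity) hΘb (fun t ht ↦ (hΘ t).deriv.trans (hψb t ht)) hv
  simp_rw [fun t ↦ (hΘ t).deriv] at hgreen
  have hparts := intervalIntegral.integral_mul_deriv_eq_deriv_mul (a := 0) (b := b)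
    (fun s _ ↦ hΘ_sq s) (fun s _ ↦ hprim s)
    ((by fun_prop : Continuous fun s : ℝ ↦ 2 * s * ψ (s ^ 2)).intervalIntegrable _ _)
    ((by fun_prop : Continuous fun s ↦ s ^ N * sphereMean (Δ v) s).intervalIntegrable _ _)
  simp only [intervalIntegral.integral_same, zero_mul, mul_zero, zero_sub] at hparts
  simp_rw [mul_sub]
  rw [intervalIntegral.integral_sub (Continuous.intervalIntegrable (by fun_prop) _ _)
    (Continuous.intervalIntegrable (by fun_prop) _ _)]
  linarith

end DivergenceTheorem

section MeanValue

section Fubini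

variable {X : Type*} [PseudoMetricSpace X] [MeasurableSpace X] [BorelSpace X] {μ : Measure X}
  {A : Set X} {f : X → ℝ}

theorem integral_indicator_mem_closedBall (hA : IsClosed A) (ρ : ℝ) (x : X) :
    ∫ z, {p : X × X | p.1 ∈ A ∧ p.2 ∈ closedBall p.1 ρ}.indicator (fun p ↦ f p.2) (z, x) ∂μ =
      μ.real (A ∩ closedBall x ρ) * f x := by
  rw [← smul_eq_mul, ← setIntegral_const,
    ← integral_indicator (hA.inter isClosed_closedBall).measurableSet]
  congr 1 with z
  simp only [indicator]
  congr 1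
  exact propext (and_congr_right' mem_closedBall_comm)

variable [ProperSpace X] [SecondCountableTopology X] [IsFiniteMeasureOnCompacts μ]

theorem integrable_indicator_mem_closedBall (hA : IsCompact A) (hAc : IsClosed A) (ρ : ℝ)
    (hf : Continuous f) :
    Integrable ({p : X × X | p.1 ∈ A ∧ p.2 ∈ closedBall p.1 ρ}.indicator fun p ↦ f p.2)
      (μ.prod μ) := by
  set S : Set (X × X) := {p | p.1 ∈ A ∧ p.2 ∈ closedBall p.1 ρ}
  have hSc : IsClosed S := (hAc.preimage continuous_fst).inter
    (isClosed_le (continuous_snd.dist continuous_fst) continuous_const)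
  have hSK : IsCompact S := by
    refine (hA.prod (hA.cthickening (r := ρ))).of_isClosed_subset hSc fun p hp ↦ ⟨hp.1, ?_⟩
    exact mem_cthickening_of_dist_le _ _ _ _ hp.1 hp.2
  exact (integrable_indicator_iff hSc.measurableSet).2
    ((hf.comp continuous_snd).continuousOn.integrableOn_compact' hSK hSc.measurableSet)

theorem integrable_measureReal_inter_closedBall_mul (hA : IsCompact A) (hAc : IsClosed A) (ρ : ℝ)
    (hf : Continuous f) : Integrable (fun x ↦ μ.real (A ∩ closedBall x ρ) * f x) μ := by
  simpa only [integral_indicator_mem_closedBall hAc] using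
    (integrable_indicator_mem_closedBall (μ := μ) hA hAc ρ hf).integral_prod_right

theorem setIntegral_setIntegral_closedBall (hA : IsCompact A) (hAc : IsClosed A) (ρ : ℝ)
    (hf : Continuous f) :
    ∫ z in A, ∫ x in closedBall z ρ, f x ∂μ ∂μ = ∫ x, μ.real (A ∩ closedBall x ρ) * f x ∂μ := by
  simp only [← integral_indicator_mem_closedBall (f := f) hAc ρ]
  rw [← integral_integral_swap
      (f := fun z x ↦
        {p : X × X | p.1 ∈ A ∧ p.2 ∈ closedBall p.1 ρ}.indicator (fun p ↦ f p.2) (z, x))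
      (integrable_indicator_mem_closedBall hA hAc ρ hf),
    ← integral_indicator hAc.measurableSet]
  congr 1 with z
  by_cases hz : z ∈ A
  · rw [indicator_of_mem hz, ← integral_indicator measurableSet_closedBall]
    simp [indicator, hz]
  · simp [indicator, hz]

end Fubini

variable {E : Type*} [NormedAddCommGroup E] [InnerProductSpace ℝ E] [FiniteDimensional ℝ E]
  [MeasurableSpace E] [BorelSpace E] {v : E → ℝ}

theorem measureReal_inter_closedBall_eq_of_norm_eq {A : Set E}
    (hA : ∀ x y, ‖x‖ = ‖y‖ → x ∈ A → y ∈ A) (ρ : ℝ) {x y : E} (hxy : ‖x‖ = ‖y‖) :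
    volume.real (A ∩ closedBall x ρ) = volume.real (A ∩ closedBall y ρ) := by
  let L := (ℝ ∙ (x - y))ᗮ.reflection
  have hL : L x = y := Submodule.reflection_sub hxy
  have hpre : L ⁻¹' (A ∩ closedBall y ρ) = A ∩ closedBall x ρ := by
    rw [preimage_inter, ← hL, L.preimage_closedBall, L.symm_apply_apply]
    congr 1 with z
    exact ⟨hA _ _ (L.norm_map z), hA _ _ (L.norm_map z).symm⟩
  rw [← hpre, Measure.real, Measure.real,
    L.measurePreserving.measure_preimage_emb L.toHomeomorph.measurableEmbedding]

/-- The mean of `v` over the closed unit ball centred at `z`, translated to the origin so that the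
domain of integration does not depend on `z`. -/
noncomputable def ballMean (v : E → ℝ) (z : E) : ℝ := ⨍ y in closedBall 0 1, v (z + y)

theorem ballMean_eq_setAverage (v : E → ℝ) (z : E) : ballMean v z = ⨍ x in closedBall z 1, v x := by
  have htrans := (measurePreserving_add_left volume z).setIntegral_preimage_emb
    (measurableEmbedding_addLeft z) v (closedBall z 1)
  rw [preimage_add_closedBall, sub_self] at htrans
  rw [ballMean, setAverage_eq, setAverage_eq, htrans, Measure.addHaar_real_closedBall_center _ z]

theorem continuous_ballMean (hv : Continuous v) : Continuous (ballMean v) := by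
  have hcont := continuous_parametric_integral_of_continuous (μ := (volume : Measure E))
    (f := fun z y ↦ v (z + y)) (by unfold Function.uncurry; fun_prop)
    (isCompact_closedBall (0 : E) 1)
  simp only [funext fun z ↦ show ballMean v z = _ from setAverage_eq _ _ _]
  exact hcont.const_smul (_ : ℝ)

theorem ballMean_sub_const (hv : Continuous v) (m : ℝ) (z : E) :
    ballMean (fun x ↦ v x - m) z = ballMean v z - m := by
  have hvol : volume.real (closedBall (0 : E) 1) ≠ 0 :=
    (ENNReal.toReal_pos (measure_closedBall_pos _ _ one_pos).ne' measure_closedBall_lt_top.ne).ne'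
  have hint {w : E → ℝ} (hw : Continuous w) : IntegrableOn w (closedBall 0 1) :=
    hw.continuousOn.integrableOn_compact (isCompact_closedBall 0 1)
  simp only [ballMean, setAverage_eq, smul_eq_mul]
  rw [integral_sub (hint (by fun_prop)) (hint continuous_const), setIntegral_const, smul_eq_mul]
  field_simp

variable [Nontrivial E]

theorem integral_mul_nonneg_of_sphereMean_nonneg {K : E → ℝ} (hK : ∀ x y, ‖x‖ = ‖y‖ → K x = K y)
    (hK0 : ∀ x, 0 ≤ K x) (hint : Integrable fun x ↦ K x * v x)
    (hv : ∀ x, K x ≠ 0 → 0 ≤ sphereMean v ‖x‖) : 0 ≤ ∫ x, K x * v x := by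
  obtain ⟨e, he⟩ := exists_norm_eq E zero_le_one
  have hKe (x : E) : K x = K (√(‖x‖ ^ 2) • e) := hK _ _ (by simp [norm_smul, he])
  have hmean : sphereMean (fun x ↦ K x * v x) = fun r ↦ K (√(r ^ 2) • e) * sphereMean v r := by
    rw [funext fun x ↦ congrArg (· * v x) (hKe x)]
    exact funext (sphereMean_radial_mul (fun t ↦ K (√t • e)) v)
  rw [integral_eq_integral_pow_mul_sphereMean hint, hmean]
  refine mul_nonneg measureReal_nonneg (setIntegral_nonneg measurableSet_Ioi fun r hr ↦ ?_)
  have hr0 : 0 ≤ r := hr.out.le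
  simp only [Real.sqrt_sq hr0]
  refine mul_nonneg (pow_nonneg hr0 _) ?_
  by_cases hne : K (r • e) = 0
  · rw [hne, zero_mul]
  · simpa [norm_smul, he, abs_of_nonneg hr0] using mul_nonneg (hK0 (r • e)) (hv _ hne)

theorem antitoneOn_sphereMean (hv : ContDiff ℝ 2 v) {ρ : ℝ} (h : ∀ x, ‖x‖ ≤ ρ → Δ v x ≤ 0) :
    AntitoneOn (sphereMean v) (Icc 0 ρ) := by
  have hderiv := hasDerivAt_sphereMean (hv.of_le one_le_two)
  refine antitoneOn_of_deriv_nonpos (convex_Icc 0 ρ)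
    (fun r _ ↦ (hderiv r).continuousAt.continuousWithinAt)
    (fun r _ ↦ (hderiv r).differentiableAt.differentiableWithinAt) fun r hr ↦ ?_
  rw [interior_Icc] at hr
  have hr0 : 0 < r := hr.1
  have hΔ : Continuous (Δ v) := (contDiff_laplacian (n := 0) (by simpa using hv)).continuous
  rw [(hderiv r).deriv]
  refine nonpos_of_mul_nonpos_right ?_ (pow_pos hr0 (finrank ℝ E - 1))
  rw [pow_mul_sphereFlux hv hr0]
  rw [← neg_nonneg, ← intervalIntegral.integral_neg]
  refine intervalIntegral.integral_nonneg hr0.le fun s hs ↦ neg_nonneg.2 ?_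
  have hmean : sphereMean (Δ v) s ≤ sphereMean (fun _ ↦ 0) s :=
    sphereMean_mono hΔ continuous_const fun x hx ↦
      h x (by rw [hx, abs_of_nonneg hs.1]; exact hs.2.trans hr.2.le)
  exact mul_nonpos_of_nonneg_of_nonpos (pow_nonneg hs.1 _) (hmean.trans_eq (sphereMean_const 0 s))

theorem setAverage_closedBall_zero_le (hv : ContDiff ℝ 2 v) {ρ : ℝ} (hρ : 0 < ρ)
    (h : ∀ x, ‖x‖ ≤ ρ → Δ v x ≤ 0) : ⨍ x in closedBall 0 ρ, v x ≤ v 0 := by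
  have hvc := hv.continuous
  have hmean (x : E) (hx : ‖x‖ ≤ ρ) : 0 ≤ sphereMean (fun y ↦ v 0 - v y) ‖x‖ := by
    rw [sphereMean_sub continuous_const hvc, sphereMean_const, ← sphereMean_zero v, sub_nonneg]
    exact antitoneOn_sphereMean hv h (left_mem_Icc.2 hρ.le) ⟨norm_nonneg x, hx⟩ (norm_nonneg x)
  have hint {w : E → ℝ} (hw : Continuous w) : IntegrableOn w (closedBall 0 ρ) :=
    hw.continuousOn.integrableOn_compact (isCompact_closedBall 0 ρ)
  have hmul (x : E) : (closedBall (0 : E) ρ).indicator (fun _ ↦ 1) x * (v 0 - v x) =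
      (closedBall 0 ρ).indicator (fun x ↦ v 0 - v x) x := by simp [indicator]
  have hnonneg : 0 ≤ ∫ x, (closedBall (0 : E) ρ).indicator (fun _ ↦ 1) x * (v 0 - v x) := by
    refine integral_mul_nonneg_of_sphereMean_nonneg (fun x y hxy ↦ ?_)
      (indicator_nonneg fun _ _ ↦ zero_le_one) ?_ fun x hx ↦ hmean x ?_
    · simp only [indicator, mem_closedBall_zero_iff, hxy]
    · simp only [hmul]
      exact (hint (continuous_const.sub hvc)).integrable_indicator measurableSet_closedBall
    · simpa using mem_of_indicator_ne_zero hx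
  simp only [hmul] at hnonneg
  rw [integral_indicator measurableSet_closedBall, integral_sub (hint continuous_const) (hint hvc),
    setIntegral_const, smul_eq_mul, sub_nonneg] at hnonneg
  have hvol : 0 < volume.real (closedBall (0 : E) ρ) :=
    ENNReal.toReal_pos (measure_closedBall_pos _ _ hρ).ne' measure_closedBall_lt_top.ne
  rwa [setAverage_eq, smul_eq_mul, inv_mul_le_iff₀ hvol]

theorem ballMean_le_of_laplacian_nonpos (hv : ContDiff ℝ 2 v) {z : E}
    (h : ∀ x ∈ closedBall z 1, Δ v x ≤ 0) : ballMean v z ≤ v z := by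
  have hle := setAverage_closedBall_zero_le (v := fun y ↦ v (z + y)) (by fun_prop) one_pos
    fun y hy ↦ by
      have hΔ := laplacian_comp_add_smul hv z 1 y
      simp only [one_smul, one_pow, one_mul] at hΔ
      rw [hΔ]
      exact h _ (by simpa using hy)
  simpa [ballMean] using hle

theorem setIntegral_ballMean_nonneg (hv : Continuous v) {A : Set E} (hA : IsCompact A)
    (hA_norm : ∀ x y, ‖x‖ = ‖y‖ → x ∈ A → y ∈ A)
    (h : ∀ x, (A ∩ closedBall x 1).Nonempty → 0 ≤ sphereMean v ‖x‖) :
    0 ≤ ∫ z in A, ballMean v z := by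
  have hK0 (x : E) (hx : volume.real (A ∩ closedBall x 1) ≠ 0) : (A ∩ closedBall x 1).Nonempty :=
    nonempty_iff_ne_empty.2 fun hempty ↦ hx (by rw [hempty, measureReal_empty])
  have hK : 0 ≤ ∫ x, volume.real (A ∩ closedBall x 1) * v x :=
    integral_mul_nonneg_of_sphereMean_nonneg
      (fun x y ↦ measureReal_inter_closedBall_eq_of_norm_eq hA_norm 1)
      (fun x ↦ measureReal_nonneg)
      (integrable_measureReal_inter_closedBall_mul hA hA.isClosed 1 hv) fun x hx ↦ h x (hK0 x hx)
  rw [← setIntegral_setIntegral_closedBall hA hA.isClosed 1 hv] at hK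
  have hmean (z : E) :
      ballMean v z = (volume.real (closedBall (0 : E) 1))⁻¹ * ∫ x in closedBall z 1, v x := by
    rw [ballMean_eq_setAverage, setAverage_eq, smul_eq_mul,
      Measure.addHaar_real_closedBall_center _ z]
  simp only [hmean, integral_const_mul]
  exact mul_nonneg (inv_nonneg.2 measureReal_nonneg) hK

theorem exists_le_ballMean_of_le_sphereMean (hv : Continuous v) {R m : ℝ} (hR : 0 ≤ R)
    (h : ∀ s, |s - R| ≤ 2 → m ≤ sphereMean v s) : ∃ z, |‖z‖ - R| ≤ 1 ∧ m ≤ ballMean v z := by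
  set A : Set E := {z | |‖z‖ - R| ≤ 1}
  have hA : IsCompact A := by
    refine (isCompact_closedBall (0 : E) (R + 1)).of_isClosed_subset
      (isClosed_le (by fun_prop) continuous_const) fun z (hz : |‖z‖ - R| ≤ 1) ↦ ?_
    rw [mem_closedBall_zero_iff]
    linarith [(abs_le.1 hz).2]
  have hA0 : volume A ≠ 0 := by
    obtain ⟨e, rfl⟩ := exists_norm_eq E hR
    refine (measure_pos_of_superset (fun x hx ↦ ?_) (measure_ball_pos volume e one_pos).ne').ne'
    exact (abs_norm_sub_norm_le x e).trans (dist_eq_norm x e ▸ (mem_ball.1 hx).le)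
  have hmean (x : E) (hx : (A ∩ closedBall x 1).Nonempty) :
      0 ≤ sphereMean (fun y ↦ v y - m) ‖x‖ := by
    obtain ⟨z, hz : |‖z‖ - R| ≤ 1, hzx⟩ := hx
    have hxz : |‖z‖ - ‖x‖| ≤ 1 := (abs_norm_sub_norm_le z x).trans (mem_closedBall_iff_norm.1 hzx)
    rw [sphereMean_sub hv continuous_const, sphereMean_const, sub_nonneg]
    rw [abs_le] at hz hxz
    exact h _ (abs_le.2 ⟨by linarith, by linarith⟩)
  have hnonneg := setIntegral_ballMean_nonneg (hv.sub continuous_const) hA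
    (fun x y hxy (hx : |‖x‖ - R| ≤ 1) ↦ show |‖y‖ - R| ≤ 1 from hxy ▸ hx) hmean
  obtain ⟨z, hzA, hz⟩ := exists_setAverage_le hA0 hA.measure_lt_top.ne
    ((continuous_ballMean (hv.sub continuous_const)).continuousOn.integrableOn_compact hA)
  rw [setAverage_eq, smul_eq_mul] at hz
  refine ⟨z, hzA, sub_nonneg.1 ?_⟩
  rw [← ballMean_sub_const hv]
  exact (mul_nonneg (inv_nonneg.2 measureReal_nonneg) hnonneg).trans hz

end MeanValue

section Harnack

variable {E : Type*} [NormedAddCommGroup E] [InnerProductSpace ℝ E]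

theorem div_two_le_norm_of_mem_segment {x y z : E} {R : ℝ} (hR : 0 ≤ R) (hx : R ≤ ‖x‖)
    (hy : R ≤ ‖y‖) (hxy : ⟪x, y⟫ = 0) (hz : z ∈ segment ℝ x y) : R / 2 ≤ ‖z‖ := by
  obtain ⟨a, b, -, -, hab, rfl⟩ := hz
  refine le_of_sq_le_sq ?_ (norm_nonneg _)
  rw [norm_add_sq_real, norm_smul, norm_smul, inner_smul_left, inner_smul_right, hxy]
  have hx' : a ^ 2 * R ^ 2 ≤ a ^ 2 * ‖x‖ ^ 2 := by gcongr
  have hy' : b ^ 2 * R ^ 2 ≤ b ^ 2 * ‖y‖ ^ 2 := by gcongr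
  have hab' : a ^ 2 + b ^ 2 ≥ 1 / 2 := by
    obtain rfl : b = 1 - a := by linarith
    nlinarith [sq_nonneg (2 * a - 1)]
  simp only [mul_pow, Real.norm_eq_abs, sq_abs, mul_zero, add_zero]
  nlinarith [mul_le_mul_of_nonneg_right hab' (sq_nonneg R)]

variable [FiniteDimensional ℝ E]

theorem exists_norm_eq_inner_eq_zero (hE : 3 ≤ finrank ℝ E) (x y : E) {R : ℝ} (hR : 0 ≤ R) :
    ∃ e : E, ‖e‖ = R ∧ ⟪x, e⟫ = 0 ∧ ⟪e, y⟫ = 0 := by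
  classical
  let S : Submodule ℝ E := Submodule.span ℝ (({x, y} : Finset E) : Set E)
  have hS : finrank ℝ S ≤ 2 := (finrank_span_finset_le_card _).trans Finset.card_le_two
  have : Nontrivial Sᗮ := by
    refine nontrivial_of_finrank_pos (R := ℝ) ?_
    have := S.finrank_add_finrank_orthogonal
    omega
  obtain ⟨e, he⟩ := exists_norm_eq Sᗮ hR
  exact ⟨e, he, Submodule.inner_right_of_mem_orthogonal (Submodule.subset_span (by simp)) e.2,
    Submodule.inner_left_of_mem_orthogonal (Submodule.subset_span (by simp)) e.2⟩

variable {v χ : E → ℝ} {c : ℝ}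

theorem fderiv_sq_gradient_le {x : E} (hχ : DifferentiableAt ℝ χ x) (hc : 0 < c) :
    fderiv ℝ (fun x ↦ χ x ^ 2) x (∇ v x) ≤
      c / 2 * (χ x ^ 2 * ‖fderiv ℝ v x‖ ^ 2) + 2 / c * ‖fderiv ℝ χ x‖ ^ 2 := by
  have hle : |χ x * fderiv ℝ χ x (∇ v x)| ≤ |χ x| * ‖fderiv ℝ v x‖ * ‖fderiv ℝ χ x‖ := by
    rw [abs_mul, mul_assoc, mul_comm ‖fderiv ℝ v x‖, ← norm_gradient v]
    exact mul_le_mul_of_nonneg_left ((fderiv ℝ χ x).le_opNorm _) (abs_nonneg _)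
  have young (a b : ℝ) : 2 * (a * b) ≤ c / 2 * a ^ 2 + 2 / c * b ^ 2 := by
    have hsq : c / 2 * a ^ 2 + 2 / c * b ^ 2 - 2 * (a * b) = (c * a - 2 * b) ^ 2 / (2 * c) := by
      field_simp
      ring
    rw [← sub_nonneg, hsq]
    positivity
  rw [fderiv_fun_pow 2 hχ]
  calc _ = 2 * (χ x * fderiv ℝ χ x (∇ v x)) := by simp; ring
    _ ≤ 2 * (|χ x| * ‖fderiv ℝ v x‖ * ‖fderiv ℝ χ x‖) := by
      linarith [le_abs_self (χ x * fderiv ℝ χ x (∇ v x))]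
    _ ≤ c / 2 * (|χ x| * ‖fderiv ℝ v x‖) ^ 2 + 2 / c * ‖fderiv ℝ χ x‖ ^ 2 := young _ _
    _ = _ := by rw [mul_pow, sq_abs]

variable [MeasurableSpace E] [BorelSpace E]

theorem integrable_sq_mul_norm_fderiv_sq (hχ : Continuous χ) (hχc : HasCompactSupport χ)
    (hv : ContDiff ℝ 1 v) : Integrable fun x ↦ χ x ^ 2 * ‖fderiv ℝ v x‖ ^ 2 :=
  (by fun_prop : Continuous _).integrable_of_hasCompactSupport
    (hχc.comp_left (g := fun t : ℝ ↦ t ^ 2) (zero_pow two_ne_zero)).mul_right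

theorem integral_sq_mul_norm_fderiv_sq_le (hχ : ContDiff ℝ 1 χ) (hχc : HasCompactSupport χ)
    (hv : ContDiff ℝ 2 v) (hc : 0 < c)
    (h : ∀ x, χ x ≠ 0 → c * ‖fderiv ℝ v x‖ ^ 2 ≤ -Δ v x) :
    ∫ x, χ x ^ 2 * ‖fderiv ℝ v x‖ ^ 2 ≤ 4 / c ^ 2 * ∫ x, ‖fderiv ℝ χ x‖ ^ 2 := by
  have hχ2 : HasCompactSupport fun x ↦ χ x ^ 2 :=
    hχc.comp_left (g := fun t : ℝ ↦ t ^ 2) (zero_pow two_ne_zero)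
  have hvf := hv.continuous_fderiv two_ne_zero
  have hΔ : Continuous (Δ v) := (contDiff_laplacian (n := 0) (by simpa using hv)).continuous
  have hint_v := integrable_sq_mul_norm_fderiv_sq hχ.continuous hχc (hv.of_le one_le_two)
  have hint_χ : Integrable fun x ↦ ‖fderiv ℝ χ x‖ ^ 2 :=
    (by fun_prop : Continuous _).integrable_of_hasCompactSupport
      ((hχc.fderiv (𝕜 := ℝ)).comp_left (g := fun L ↦ ‖L‖ ^ 2) (by simp))
  have hint_Δ : Integrable fun x ↦ χ x ^ 2 * Δ v x :=
    (by fun_prop : Continuous _).integrable_of_hasCompactSupport hχ2.mul_right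
  have hge : c * ∫ x, χ x ^ 2 * ‖fderiv ℝ v x‖ ^ 2 ≤ -∫ x, χ x ^ 2 * Δ v x := by
    rw [← integral_const_mul, ← integral_neg]
    refine integral_mono (hint_v.const_mul c) hint_Δ.neg fun x ↦ ?_
    by_cases hx : χ x = 0
    · simp [hx]
    · linarith [mul_le_mul_of_nonneg_left (h x hx) (sq_nonneg (χ x))]
  have hle : ∫ x, fderiv ℝ (fun x ↦ χ x ^ 2) x (∇ v x) ≤
      c / 2 * (∫ x, χ x ^ 2 * ‖fderiv ℝ v x‖ ^ 2) + 2 / c * ∫ x, ‖fderiv ℝ χ x‖ ^ 2 := by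
    rw [← integral_const_mul, ← integral_const_mul,
      ← integral_add (hint_v.const_mul _) (hint_χ.const_mul _)]
    refine integral_mono ?_ ((hint_v.const_mul _).add (hint_χ.const_mul _))
      fun x ↦ fderiv_sq_gradient_le (hχ.differentiable one_ne_zero x) hc
    refine Continuous.integrable_of_hasCompactSupport ?_
      ((hχ2.fderiv (𝕜 := ℝ)).mono fun x hx h0 ↦ hx (by simp only [h0, zero_apply]))
    exact ((hχ.pow 2).continuous_fderiv one_ne_zero).clm_apply
      ((InnerProductSpace.toDual ℝ E).symm.continuous.comp hvf)
  rw [integral_mul_laplacian (hχ.pow 2) hχ2 hv, neg_neg] at hge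
  have hhalf : c / 2 * ∫ x, χ x ^ 2 * ‖fderiv ℝ v x‖ ^ 2 ≤ 2 / c * ∫ x, ‖fderiv ℝ χ x‖ ^ 2 := by
    linarith
  calc ∫ x, χ x ^ 2 * ‖fderiv ℝ v x‖ ^ 2
      = 2 / c * (c / 2 * ∫ x, χ x ^ 2 * ‖fderiv ℝ v x‖ ^ 2) := by field_simp
    _ ≤ 2 / c * (2 / c * ∫ x, ‖fderiv ℝ χ x‖ ^ 2) := by gcongr
    _ = 4 / c ^ 2 * ∫ x, ‖fderiv ℝ χ x‖ ^ 2 := by ring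

theorem setIntegral_norm_fderiv_le {K : Set E} (hK : IsCompact K) (hχ : ContDiff ℝ 1 χ)
    (hχc : HasCompactSupport χ) (hχK : ∀ x ∈ K, χ x = 1) (hv : ContDiff ℝ 2 v) (hc : 0 < c)
    (h : ∀ x, χ x ≠ 0 → c * ‖fderiv ℝ v x‖ ^ 2 ≤ -Δ v x) :
    ∫ x in K, ‖fderiv ℝ v x‖ ≤ volume.real K + 4 / c ^ 2 * ∫ x, ‖fderiv ℝ χ x‖ ^ 2 := by
  have hint := integrable_sq_mul_norm_fderiv_sq hχ.continuous hχc (hv.of_le one_le_two)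
  have hone : IntegrableOn (fun _ ↦ (1 : ℝ)) K := integrableOn_const hK.measure_lt_top.ne
  calc ∫ x in K, ‖fderiv ℝ v x‖
      ≤ ∫ x in K, (1 + χ x ^ 2 * ‖fderiv ℝ v x‖ ^ 2) := by
        refine setIntegral_mono_on
          ((hv.continuous_fderiv two_ne_zero).norm.continuousOn.integrableOn_compact hK)
          (hone.add hint.integrableOn) hK.measurableSet fun x hx ↦ ?_
        rw [hχK x hx]
        nlinarith [sq_nonneg (‖fderiv ℝ v x‖ - 1)]
    _ = volume.real K + ∫ x in K, χ x ^ 2 * ‖fderiv ℝ v x‖ ^ 2 := by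
        rw [integral_add hone hint.integrableOn, setIntegral_const, smul_eq_mul, mul_one]
    _ ≤ _ := by
        gcongr
        exact (setIntegral_le_integral hint (ae_of_all _ fun x ↦ by positivity)).trans
          (integral_sq_mul_norm_fderiv_sq_le hχ hχc hv hc h)

theorem exists_ballMean_norm_fderiv_le (hc : 0 < c) :
    ∃ C, 0 ≤ C ∧ ∀ (v : E → ℝ) (z : E), ContDiff ℝ 2 v →
      (∀ x ∈ closedBall z 2, c * ‖fderiv ℝ v x‖ ^ 2 ≤ -Δ v x) →
        ballMean (fun x ↦ ‖fderiv ℝ v x‖) z ≤ C := by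
  let χ : ContDiffBump (0 : E) := ⟨1, 2, one_pos, one_lt_two⟩
  refine ⟨(volume.real (closedBall (0 : E) 1))⁻¹ *
    (volume.real (closedBall (0 : E) 1) + 4 / c ^ 2 * ∫ x, ‖fderiv ℝ χ x‖ ^ 2), by positivity,
    fun v z hv h ↦ ?_⟩
  rw [ballMean, setAverage_eq, smul_eq_mul]
  gcongr
  simp only [← fderiv_comp_add_left]
  refine setIntegral_norm_fderiv_le (isCompact_closedBall 0 1) χ.contDiff χ.hasCompactSupport
    (fun y hy ↦ χ.one_of_mem_closedBall hy) (by fun_prop) hc fun y hy ↦ ?_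
  have hΔ := laplacian_comp_add_smul hv z 1 y
  simp only [one_smul, one_pow, one_mul] at hΔ
  rw [fderiv_comp_add_left, hΔ]
  have hy2 : y ∈ ball 0 2 := χ.support_eq ▸ Function.mem_support.2 hy
  exact h _ (by simpa using (mem_ball_zero_iff.1 hy2).le)

theorem hasDerivAt_ballMean_add_smul (hv : ContDiff ℝ 1 v) (z w : E) (t : ℝ) :
    HasDerivAt (fun t : ℝ ↦ ballMean v (z + t • w))
      (ballMean (fun x ↦ fderiv ℝ v x w) (z + t • w)) t := by
  simp only [ballMean, setAverage_eq, smul_eq_mul]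
  refine (hasDerivAt_setIntegral_of_isCompact (μ := volume)
    (F := fun (t : ℝ) y ↦ v (z + t • w + y)) (F' := fun (t : ℝ) y ↦ fderiv ℝ v (z + t • w + y) w)
    (by unfold Function.uncurry; fun_prop) (by unfold Function.uncurry; fun_prop) (fun t y ↦ ?_)
    (isCompact_closedBall 0 1) measurableSet_closedBall t).const_mul _
  have hline : HasDerivAt (fun t : ℝ ↦ z + t • w + y) w t := by
    simpa using (((hasDerivAt_id t).smul_const w).const_add z).add_const y
  exact (hv.differentiable one_ne_zero _).hasFDerivAt.comp_hasDerivAt t hline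

theorem abs_ballMean_sub_le_of_segment (hv : ContDiff ℝ 1 v) {x y : E} {C : ℝ}
    (h : ∀ z ∈ segment ℝ x y, ballMean (fun x ↦ ‖fderiv ℝ v x‖) z ≤ C) :
    |ballMean v y - ballMean v x| ≤ C * ‖y - x‖ := by
  have hderiv (z : E) (hz : z ∈ segment ℝ x y) :
      ‖ballMean (fun x' ↦ fderiv ℝ v x' (y - x)) z‖ ≤ C * ‖y - x‖ := by
    have hint : IntegrableOn (fun x' ↦ ‖fderiv ℝ v (z + x')‖) (closedBall 0 1) :=
      (by fun_prop : Continuous _).continuousOn.integrableOn_compact (isCompact_closedBall 0 1)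
    calc _ ≤ ballMean (fun x' ↦ ‖fderiv ℝ v x'‖ * ‖y - x‖) z :=
          norm_integral_le_of_norm_le (hint.to_average.mul_const _)
            (ae_of_all _ fun x' ↦ (fderiv ℝ v (z + x')).le_opNorm _)
      _ = ballMean (fun x' ↦ ‖fderiv ℝ v x'‖) z * ‖y - x‖ := integral_mul_const _ _
      _ ≤ C * ‖y - x‖ := by gcongr; exact h z hz
  have hle := norm_image_sub_le_of_norm_deriv_le_segment_01'
    (f := fun t : ℝ ↦ ballMean v (x + t • (y - x)))
    (fun t _ ↦ (hasDerivAt_ballMean_add_smul hv x (y - x) t).hasDerivWithinAt)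
    fun t ht ↦ hderiv _ (segment_eq_image' ℝ x y ▸ mem_image_of_mem _ (Ico_subset_Icc_self ht))
  simpa using hle

theorem exists_forall_le_sphereMean_le_add_of_norm_eq (hE : 3 ≤ finrank ℝ E) (hc : 0 < c) :
    ∃ C, ∀ (v : E → ℝ) (m : ℝ), ContDiff ℝ 2 v →
      (∀ x, 2 ≤ ‖x‖ → c * ‖fderiv ℝ v x‖ ^ 2 ≤ -Δ v x) →
        (∀ s, |s - 9| ≤ 2 → m ≤ sphereMean v s) → ∀ x, ‖x‖ = 9 → m ≤ v x + C := by
  have : Nontrivial E := nontrivial_of_finrank_pos (R := ℝ) (by omega)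
  obtain ⟨C, hC0, hC⟩ := exists_ballMean_norm_fderiv_le (E := E) hc
  refine ⟨C * 18 + C * 19, fun v m hv h hm x hx ↦ ?_⟩
  obtain ⟨z, hz, hmz⟩ := exists_le_ballMean_of_le_sphereMean hv.continuous (by norm_num) hm
  obtain ⟨e, he, hxe, hez⟩ := exists_norm_eq_inner_eq_zero hE x z (R := 9) (by norm_num)
  rw [abs_le] at hz
  have hgrad {a b p : E} (ha : 8 ≤ ‖a‖) (hb : 8 ≤ ‖b‖) (hab : ⟪a, b⟫ = 0)
      (hp : p ∈ segment ℝ a b) : ballMean (fun x ↦ ‖fderiv ℝ v x‖) p ≤ C := by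
    have hp4 := div_two_le_norm_of_mem_segment (by norm_num) ha hb hab hp
    refine hC v p hv fun y hy ↦ h y ?_
    have := norm_le_norm_add_norm_sub' p y
    have := mem_closedBall_iff_norm'.1 hy
    linarith
  have hxe' : |ballMean v e - ballMean v x| ≤ C * 18 :=
    (abs_ballMean_sub_le_of_segment (hv.of_le one_le_two)
      fun p ↦ hgrad (by linarith) (by linarith) hxe).trans
      (mul_le_mul_of_nonneg_left ((norm_sub_le e x).trans (by linarith)) hC0)
  have hez' : |ballMean v z - ballMean v e| ≤ C * 19 :=
    (abs_ballMean_sub_le_of_segment (hv.of_le one_le_two)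
      fun p ↦ hgrad (by linarith) (by linarith) hez).trans
      (mul_le_mul_of_nonneg_left ((norm_sub_le z e).trans (by linarith)) hC0)
  have hx_mean : ballMean v x ≤ v x := ballMean_le_of_laplacian_nonpos hv fun y hy ↦ by
    have := norm_le_norm_add_norm_sub' x y
    have := mem_closedBall_iff_norm'.1 hy
    have : 0 ≤ c * ‖fderiv ℝ v y‖ ^ 2 := by positivity
    linarith [h y (by linarith)]
  linarith [(abs_le.1 hxe').2, (abs_le.1 hez').2]

theorem exists_forall_le_sphereMean_le_add (hE : 3 ≤ finrank ℝ E) (hc : 0 < c)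
    (hv : ContDiff ℝ 2 v) {R₀ : ℝ} (h : ∀ x, R₀ ≤ ‖x‖ → c * ‖fderiv ℝ v x‖ ^ 2 ≤ -Δ v x) :
    ∃ C, ∀ x, 0 < ‖x‖ → 5 * R₀ ≤ ‖x‖ → ∀ m,
      (∀ s ∈ Icc (‖x‖ / 2) (2 * ‖x‖), m ≤ sphereMean v s) → m ≤ v x + C := by
  obtain ⟨C, hC⟩ := exists_forall_le_sphereMean_le_add_of_norm_eq hE hc
  refine ⟨C, fun x hx hxR m hm ↦ ?_⟩
  set ρ := ‖x‖ / 9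
  have hρ : 0 < ρ := by positivity
  have hxρ : ‖x‖ = 9 * ρ := by simp only [ρ]; ring
  have hfderiv (y : E) : fderiv ℝ (fun y ↦ v (ρ • y)) y = ρ • fderiv ℝ v (ρ • y) := by
    simpa using fderiv_comp_add_smul (u := v) 0 ρ y
  have hΔ (y : E) : Δ (fun y ↦ v (ρ • y)) y = ρ ^ 2 * Δ v (ρ • y) := by
    simpa using laplacian_comp_add_smul hv 0 ρ y
  have hmean (s : ℝ) : sphereMean (fun y ↦ v (ρ • y)) s = sphereMean v (ρ * s) := by
    simp only [sphereMean, smul_smul]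
  have hx_scaled := hC (fun y ↦ v (ρ • y)) m (by fun_prop) (fun y hy ↦ ?_) (fun s hs ↦ ?_)
    (ρ⁻¹ • x) ?_
  · rwa [smul_inv_smul₀ hρ.ne'] at hx_scaled
  · have hρy : R₀ ≤ ‖ρ • y‖ := by
      rw [norm_smul, Real.norm_of_nonneg hρ.le]
      nlinarith
    rw [hfderiv, hΔ, norm_smul, Real.norm_of_nonneg hρ.le]
    linarith [mul_le_mul_of_nonneg_left (h _ hρy) (sq_nonneg ρ)]
  · rw [hmean]
    rw [abs_le] at hs
    exact hm _ ⟨by rw [hxρ]; nlinarith, by rw [hxρ]; nlinarith⟩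
  · rw [norm_smul, norm_inv, Real.norm_of_nonneg hρ.le, hxρ]
    field_simp

end Harnack

section Completeness

theorem enorm_sub_le_lintegral_mul_enorm_deriv {E : Type*} [NormedAddCommGroup E]
    [NormedSpace ℝ E] {F : E → ℝ} {γ : ℝ → E} (hF : ContDiff ℝ 1 F)
    (hγ : ContDiffOn ℝ 1 γ (Icc 0 1)) :
    ‖F (γ 1) - F (γ 0)‖ₑ ≤ ∫⁻ t in Icc (0 : ℝ) 1, ‖fderiv ℝ F (γ t)‖ₑ * ‖deriv γ t‖ₑ := by
  have hFγ : ContDiffOn ℝ 1 (F ∘ γ) (Icc 0 1) := hF.comp_contDiffOn hγ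
  have hderiv (t : ℝ) (ht : t ∈ Ioo (0 : ℝ) 1) :
      HasDerivAt (F ∘ γ) (fderiv ℝ F (γ t) (deriv γ t)) t :=
    (hF.differentiable one_ne_zero (γ t)).hasFDerivAt.comp_hasDerivAt t
      ((hγ.differentiableOn one_ne_zero).differentiableAt
        (Icc_mem_nhds ht.1 ht.2)).hasDerivAt
  have hint : IntegrableOn (deriv (F ∘ γ)) (Ioo 0 1) := by
    refine (((hFγ.continuousOn_derivWithin (uniqueDiffOn_Icc zero_lt_one) le_rfl).integrableOn_Icc
      (μ := volume)).mono_set Ioo_subset_Icc_self).congr_fun (fun t ht ↦ ?_) measurableSet_Ioo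
    exact derivWithin_of_mem_nhds (Icc_mem_nhds ht.1 ht.2)
  have hftc : ∫ t in (0 : ℝ)..1, deriv (F ∘ γ) t = F (γ 1) - F (γ 0) :=
    intervalIntegral.integral_eq_sub_of_hasDerivAt_of_le zero_le_one hFγ.continuousOn
      (fun t ht ↦ (hderiv t ht).differentiableAt.hasDerivAt)
      ((intervalIntegrable_iff_integrableOn_Ioo_of_le zero_le_one).2 hint)
  rw [← hftc, intervalIntegral.integral_of_le zero_le_one, ← restrict_Ioo_eq_restrict_Ioc,
    ← restrict_Ioo_eq_restrict_Icc]
  refine (enorm_integral_le_lintegral_enorm _).trans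
    (setLIntegral_mono' measurableSet_Ioo fun t ht ↦ ?_)
  rw [(hderiv t ht).deriv]
  exact (fderiv ℝ F (γ t)).le_opENorm _

theorem norm_fderiv_log_one_add_norm_sq_le {E : Type*} [NormedAddCommGroup E]
    [InnerProductSpace ℝ E] (x : E) :
    ‖fderiv ℝ (fun x : E ↦ Real.log (1 + ‖x‖ ^ 2)) x‖ ≤ 3 / (1 + ‖x‖) := by
  have hderiv : HasFDerivAt (fun x : E ↦ Real.log (1 + ‖x‖ ^ 2))
      ((1 + ‖x‖ ^ 2)⁻¹ • ((2 : ℝ) • innerSL ℝ x)) x := by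
    simpa only [← ofNat_smul_eq_nsmul ℝ 2] using
      ((hasStrictFDerivAt_norm_sq x).hasFDerivAt.const_add 1).log (by positivity)
  rw [hderiv.fderiv, norm_smul, norm_smul, innerSL_apply_norm, Real.norm_of_nonneg (by positivity),
    Real.norm_ofNat, ← div_eq_inv_mul, div_le_div_iff₀ (by positivity) (by positivity)]
  nlinarith [sq_nonneg (‖x‖ - 1)]

variable {n : ℕ} {u F : Euc n → ℝ}

theorem tangentLength_conformalMetric (u : Euc n → ℝ) (x v : Euc n) :
    tangentLength (conformalMetric u) x v = Real.exp (u x) * ‖v‖ := by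
  have hexp : Real.exp (2 * u x) = Real.exp (u x) ^ 2 := by simp [← Real.exp_nat_mul]
  have hsq : ∑ i, ∑ j, conformalMetric u x i j * v i * v j = (Real.exp (u x) * ‖v‖) ^ 2 := by
    simp only [conformalMetric, Matrix.smul_apply, Matrix.one_apply, smul_eq_mul, mul_ite, mul_one,
      mul_zero, ite_mul, zero_mul, Finset.sum_ite_eq, Finset.mem_univ, if_true, mul_pow,
      EuclideanSpace.norm_sq_eq, Finset.mul_sum, hexp, Real.norm_eq_abs, sq_abs]
    exact Finset.sum_congr rfl fun i _ ↦ by ring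
  rw [tangentLength, hsq, Real.sqrt_sq (by positivity)]

theorem pathELength_conformalMetric (u : Euc n → ℝ) (γ : ℝ → Euc n) (a b : ℝ) :
    letI := tangentENorm (conformalMetric u)
    Manifold.pathELength 𝓘(ℝ, Euc n) γ a b =
      ∫⁻ t in Icc a b, ENNReal.ofReal (Real.exp (u (γ t)) * ‖deriv γ t‖) := by
  let _ := tangentENorm (conformalMetric u)
  rw [Manifold.pathELength_eq_lintegral_mfderiv_Icc]
  refine lintegral_congr fun t ↦ ?_
  rw [← tangentLength_conformalMetric, ← fderiv_apply_one_eq_deriv, ← mfderiv_eq_fderiv]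
  rfl

theorem geodesicEDist_conformalMetric_le {x y : Euc n} {M : ℝ}
    (hM : ∀ z ∈ segment ℝ x y, Real.exp (u z) ≤ M) :
    geodesicEDist (conformalMetric u) x y ≤ ENNReal.ofReal (M * ‖y - x‖) := by
  let _ := tangentENorm (conformalMetric u)
  have _ := tangentENorm_smulClass (conformalMetric u)
  let γ : ℝ → Euc n := fun t ↦ x + t • (y - x)
  have hγ (t : ℝ) : HasDerivAt γ (y - x) t := by
    simpa [γ] using ((hasDerivAt_id t).smul_const (y - x)).const_add x
  have hγ1 : ContDiff ℝ 1 γ := by fun_prop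
  calc geodesicEDist (conformalMetric u) x y
      ≤ Manifold.pathELength 𝓘(ℝ, Euc n) γ 0 1 :=
        Manifold.riemannianEDist_le_pathELength (contMDiffOn_iff_contDiffOn.2 hγ1.contDiffOn)
          (by simp [γ]) (by simp [γ]) zero_le_one
    _ = ∫⁻ t in Icc (0 : ℝ) 1, ENNReal.ofReal (Real.exp (u (γ t)) * ‖deriv γ t‖) :=
        pathELength_conformalMetric u γ 0 1
    _ ≤ ∫⁻ _ in Icc (0 : ℝ) 1, ENNReal.ofReal (M * ‖y - x‖) := by
        refine setLIntegral_mono measurable_const fun t ht ↦ ?_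
        rw [(hγ t).deriv]
        gcongr
        exact hM _ (segment_eq_image' ℝ x y ▸ mem_image_of_mem γ ht)
    _ = ENNReal.ofReal (M * ‖y - x‖) := by simp

theorem tendsto_geodesicEDist_conformalMetric (hu : Continuous u) {ι : Type*} {l : Filter ι}
    {s : ι → Euc n} {x : Euc n} (hs : Tendsto s l (𝓝 x)) :
    Tendsto (fun i ↦ geodesicEDist (conformalMetric u) (s i) x) l (𝓝 0) := by
  obtain ⟨M, hM⟩ := (isCompact_closedBall x 1).exists_bound_of_continuousOn
    (Real.continuous_exp.comp hu).continuousOn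
  have hdist : Tendsto (fun i ↦ ENNReal.ofReal (M * ‖x - s i‖)) l (𝓝 0) := by
    simpa using ENNReal.tendsto_ofReal (((tendsto_const_nhds (x := x)).sub hs).norm.const_mul M)
  refine tendsto_of_tendsto_of_tendsto_of_le_of_le' tendsto_const_nhds hdist
    (Eventually.of_forall fun _ ↦ zero_le) ?_
  filter_upwards [hs.eventually (closedBall_mem_nhds x one_pos)] with i hi
  refine geodesicEDist_conformalMetric_le fun z hz ↦ (le_abs_self _).trans (hM z ?_)
  exact (convex_closedBall x 1).segment_subset hi (mem_closedBall_self zero_le_one) hz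

theorem enorm_sub_le_geodesicEDist (hF : ContDiff ℝ 1 F)
    (h : ∀ x, ‖fderiv ℝ F x‖ ≤ Real.exp (u x)) (x y : Euc n) :
    ‖F y - F x‖ₑ ≤ geodesicEDist (conformalMetric u) x y := by
  let _ := tangentENorm (conformalMetric u)
  refine le_of_forall_gt fun r hr ↦ ?_
  obtain ⟨γ, rfl, rfl, hγ, hlen⟩ := Manifold.exists_lt_of_riemannianEDist_lt hr
  refine lt_of_le_of_lt ?_ hlen
  rw [pathELength_conformalMetric]
  refine (enorm_sub_le_lintegral_mul_enorm_deriv hF (contMDiffOn_iff_contDiffOn.1 hγ)).trans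
    (lintegral_mono fun t ↦ ?_)
  rw [ENNReal.ofReal_mul (Real.exp_nonneg _), ofReal_norm, ← ofReal_norm]
  gcongr
  exact h _

theorem isCompleteMetric_of_tendsto_cocompact (hu : Continuous u) (hF : ContDiff ℝ 1 F)
    (h : ∀ x, ‖fderiv ℝ F x‖ ≤ Real.exp (u x)) (hlim : Tendsto F (cocompact (Euc n)) atTop) :
    IsCompleteMetric (conformalMetric u) := by
  let inst := geodesicSpace (conformalMetric u)
  refine @EMetric.complete_of_cauchySeq_tendsto (Euc n) inst fun s hs ↦ ?_
  obtain ⟨N, hN⟩ := (@EMetric.cauchySeq_iff (Euc n) ℕ inst _ _ s).1 hs 1 one_pos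
  have hFs (k : ℕ) : F (s (N + k)) < F (s N) + 1 := by
    have hlt : ‖F (s (N + k)) - F (s N)‖ₑ < 1 :=
      (enorm_sub_le_geodesicEDist hF h _ _).trans_lt (hN N le_rfl (N + k) (N.le_add_right k))
    rw [Real.enorm_eq_ofReal_abs, ENNReal.ofReal_lt_one] at hlt
    linarith [(abs_lt.1 hlt).2]
  obtain ⟨K, hK, hKF⟩ := mem_cocompact.1 (hlim.eventually_ge_atTop (F (s N) + 1))
  have hsK (k : ℕ) : s (N + k) ∈ K := by
    by_contra hk
    exact (hFs k).not_ge (hKF hk)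
  obtain ⟨x, -, φ, hφ, hφx⟩ := hK.tendsto_subseq hsK
  have hφN : Tendsto (fun k ↦ N + φ k) atTop atTop :=
    tendsto_atTop_mono (fun k ↦ Nat.le_add_left _ _) hφ.tendsto_atTop
  exact ⟨x, @tendsto_nhds_of_cauchySeq_of_subseq _ _ inst.toUniformSpace _ _ hs _ _ _ _ hφN _
    ((@tendsto_iff_edist_tendsto_0 (Euc n) ℕ inst _ _ _).2
      (tendsto_geodesicEDist_conformalMetric hu hφx))⟩

theorem isCompleteMetric_of_div_one_add_norm_le (hu : Continuous u) {a : ℝ} (ha : 0 < a)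
    (h : ∀ x, a / (1 + ‖x‖) ≤ Real.exp (u x)) : IsCompleteMetric (conformalMetric u) := by
  have hlog : ContDiff ℝ 1 fun x : Euc n ↦ Real.log (1 + ‖x‖ ^ 2) :=
    (contDiff_const.add (contDiff_norm_sq ℝ)).log fun x ↦ by positivity
  refine isCompleteMetric_of_tendsto_cocompact hu (F := fun x ↦ a / 3 * Real.log (1 + ‖x‖ ^ 2))
    (contDiff_const.mul hlog) (fun x ↦ ?_) ?_
  · rw [fderiv_const_mul (hlog.differentiable one_ne_zero x), norm_smul,
      Real.norm_of_nonneg (by positivity)]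
    calc a / 3 * _ ≤ a / 3 * (3 / (1 + ‖x‖)) := by
          gcongr
          exact norm_fderiv_log_one_add_norm_sq_le x
      _ = a / (1 + ‖x‖) := by ring
      _ ≤ Real.exp (u x) := h x
  · exact (Real.tendsto_log_atTop.comp (tendsto_atTop_add_const_left _ 1
      ((tendsto_pow_atTop two_ne_zero).comp tendsto_norm_cocompact_atTop))).const_mul_atTop
        (by positivity)

end Completeness

section SphereVolume

theorem toSphere_real_univ_eq {n : ℕ} (hn : n ≠ 0) :
    (volume : Measure (Euc n)).toSphere.real univ = 2 * √Real.pi ^ n / Real.Gamma (n / 2) := by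
  have : Nonempty (Fin n) := ⟨⟨0, hn.bot_lt⟩⟩
  have hn0 : (n : ℝ) / 2 ≠ 0 := by positivity
  rw [Measure.toSphere_real_apply_univ, finrank_euclideanSpace_fin, Measure.real,
    EuclideanSpace.volume_ball, Fintype.card_fin, ENNReal.ofReal_one, one_pow, one_mul,
    ENNReal.toReal_ofReal (by positivity), Real.Gamma_add_one hn0]
  field_simp

/-- With `|𝕊^{n-1}| = 2 π^{n/2} / Γ(n/2)`, this is Legendre's duplication formula at `m`. -/
theorem factorial_mul_sphereVolume {m : ℕ} (hm : 1 ≤ m) :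
    ((2 * m - 1).factorial : ℝ) * sphereVolume (2 * m) / 2 =
      (volume : Measure (Euc (2 * m))).toSphere.real univ *
        (2 ^ (m - 1) * (m - 1).factorial) ^ 2 := by
  obtain ⟨k, rfl⟩ : ∃ k, m = k + 1 := ⟨m - 1, by omega⟩
  have hduplication := Real.Gamma_mul_Gamma_add_half ((k + 1 : ℕ) : ℝ)
  have hΓ : 0 < Real.Gamma (((k + 1 : ℕ) : ℝ) + 1 / 2) := Real.Gamma_pos_of_pos (by positivity)
  have hpow : (2 : ℝ) ^ (1 - 2 * ((k + 1 : ℕ) : ℝ)) = (2 * (2 ^ k) ^ 2)⁻¹ := by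
    rw [← pow_mul, ← pow_succ', ← Real.rpow_natCast, ← Real.rpow_neg zero_le_two]
    push_cast
    ring_nf
  have hΓ_even : Real.Gamma (2 * ((k + 1 : ℕ) : ℝ)) = (2 * k + 1).factorial := by
    rw [← Real.Gamma_nat_eq_factorial]
    push_cast
    ring_nf
  have hΓ_half : Real.Gamma ((k + 1 : ℕ) : ℝ) = k.factorial := by
    rw [← Real.Gamma_nat_eq_factorial, Nat.cast_succ]
  have hodd : ((2 * (k + 1) + 1 : ℕ) : ℝ) / 2 = ((k + 1 : ℕ) : ℝ) + 1 / 2 := by push_cast; ring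
  have heven : ((2 * (k + 1) : ℕ) : ℝ) / 2 = ((k + 1 : ℕ) : ℝ) := by push_cast; ring
  rw [hpow, hΓ_even, hΓ_half] at hduplication
  rw [sphereVolume, toSphere_real_univ_eq (by omega), toSphere_real_univ_eq (by omega), hodd, heven,
    hΓ_half, Nat.add_sub_cancel, show 2 * (k + 1) - 1 = 2 * k + 1 by omega]
  field_simp at hduplication ⊢
  linear_combination -√Real.pi ^ (2 * (k + 1)) * hduplication

end SphereVolume

section Asymptotics

variable {E : Type*} [NormedAddCommGroup E] [InnerProductSpace ℝ E] [FiniteDimensional ℝ E]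
  [MeasurableSpace E] [BorelSpace E] {m : ℕ} {u : E → ℝ} {b c R₀ : ℝ}

theorem tendsto_integral_pow_mul_sphereMean [Nontrivial E] {F : E → ℝ} (hF : Integrable F) :
    Tendsto (fun r ↦ ∫ s in 0..r, s ^ (finrank ℝ E - 1) * sphereMean F s) atTop
      (𝓝 ((∫ x, F x) / (volume : Measure E).toSphere.real univ)) := by
  rw [integral_eq_integral_pow_mul_sphereMean hF, mul_div_cancel_left₀ _ toSphere_real_univ_pos.ne']
  exact intervalIntegral_tendsto_integral_Ioi 0 (integrableOn_pow_mul_sphereMean hF) tendsto_id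

theorem tendsto_mul_sphereFlux (hm : 1 ≤ m) (hE : finrank ℝ E = 2 * m) (hu : ContDiff ℝ ∞ u)
    (hQ : Integrable ((fun f ↦ -Δ f)^[m] u)) (hc : 0 < c)
    (h : ∀ x, R₀ ≤ ‖x‖ → c * ‖fderiv ℝ u x‖ ^ 2 ≤ -Δ u x) :
    Tendsto (fun r ↦ r * sphereFlux u r) atTop
      (𝓝 (-((∫ x, (fun f ↦ -Δ f)^[m] u x) / (volume : Measure E).toSphere.real univ /
        (2 ^ (m - 1) * (m - 1).factorial) ^ 2))) := by
  have : Nontrivial E := nontrivial_of_finrank_pos (R := ℝ) (by omega)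
  have hsmooth (k : ℕ) := contDiff_iterate_neg_laplacian hu k
  have hsucc (k : ℕ) : (fun f ↦ -Δ f)^[k + 1] u = -Δ ((fun f ↦ -Δ f)^[k] u) :=
    Function.iterate_succ_apply' _ _ _
  refine tendsto_mul_of_radial_system hm (v := fun k ↦ sphereMean ((fun f ↦ -Δ f)^[k] u))
    (p := fun k ↦ sphereFlux ((fun f ↦ -Δ f)^[k] u))
    (fun k r ↦ hasDerivAt_sphereMean (contDiff_infty.1 (hsmooth k) 1) r)
    (fun k ↦ continuous_sphereFlux (contDiff_infty.1 (hsmooth k) 1))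
    (fun k ↦ ⟨continuous_sphereMean (hsmooth (k + 1)).continuous, fun r hr ↦ ?_⟩)
    (hE ▸ tendsto_integral_pow_mul_sphereMean hQ) hc ?_
  · have hflux := pow_mul_sphereFlux (contDiff_infty.1 (hsmooth k) 2) hr
    rw [hE] at hflux
    simp only [hflux, hsucc, sphereMean_neg, mul_neg, intervalIntegral.integral_neg, neg_neg]
  · filter_upwards [eventually_ge_atTop R₀, eventually_ge_atTop 0] with r hr hr0
    refine mul_sphereFlux_sq_le_of_norm_fderiv_sq_le (contDiff_infty.1 hu 2) hc.le fun x hx ↦ h x ?_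
    rwa [hx, abs_of_nonneg hr0]

theorem exists_eventually_mul_log_sub_le_sphereMean (hu : ContDiff ℝ 1 u)
    (hb : ∀ᶠ r in atTop, b ≤ r * sphereFlux u r) :
    ∃ C, ∀ᶠ r in atTop, b * Real.log r - C ≤ sphereMean u r := by
  refine exists_eventually_sub_le_of_deriv_le (g := fun r ↦ b * Real.log r)
    (Eventually.of_forall fun r ↦ hasDerivAt_sphereMean hu r)
    ((eventually_gt_atTop 0).mono fun r hr ↦ (Real.hasDerivAt_log hr.ne').const_mul b) ?_
  filter_upwards [hb, eventually_gt_atTop 0] with r hr hr0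
  rwa [← div_eq_mul_inv, div_le_iff₀' hr0]

theorem exists_eventually_neg_log_one_add_norm_sub_le (hE : 3 ≤ finrank ℝ E) (hc : 0 < c)
    (hu : ContDiff ℝ 2 u) (h : ∀ x, R₀ ≤ ‖x‖ → c * ‖fderiv ℝ u x‖ ^ 2 ≤ -Δ u x) {C₁ : ℝ}
    (hmean : ∀ᶠ r in atTop, -Real.log r - C₁ ≤ sphereMean u r) :
    ∃ C, ∀ᶠ x in cocompact E, -Real.log (1 + ‖x‖) - C ≤ u x := by
  obtain ⟨R₁, hR₁⟩ := eventually_atTop.1 hmean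
  obtain ⟨C₂, hC₂⟩ := exists_forall_le_sphereMean_le_add hE hc hu h
  have hnorm := tendsto_norm_cocompact_atTop (E := E)
  refine ⟨Real.log 2 + C₁ + C₂, ?_⟩
  filter_upwards [hnorm.eventually_gt_atTop 0, hnorm.eventually_ge_atTop (5 * R₀),
    hnorm.eventually_ge_atTop (2 * R₁)] with x hx0 hxR₀ hxR₁
  have hlower := hC₂ x hx0 hxR₀ (-Real.log (2 * (1 + ‖x‖)) - C₁) fun s hs ↦ by
    have hlog : Real.log s ≤ Real.log (2 * (1 + ‖x‖)) :=
      Real.log_le_log (by linarith [hs.1]) (by linarith [hs.2])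
    linarith [hR₁ s (by linarith [hs.1])]
  rw [Real.log_mul two_ne_zero (by positivity)] at hlower
  linarith

theorem bddBelow_range_of_eventually_cocompact_le {X : Type*} [TopologicalSpace X] {f : X → ℝ}
    (hf : Continuous f) {b : ℝ} (h : ∀ᶠ x in cocompact X, b ≤ f x) : BddBelow (range f) := by
  obtain ⟨K, hK, hKf⟩ := mem_cocompact.1 h
  obtain ⟨b', hb'⟩ := hK.bddBelow_image hf.continuousOn
  refine ⟨min b b', forall_mem_range.2 fun x ↦ ?_⟩
  by_cases hx : x ∈ K
  · exact min_le_of_right_le (hb' (mem_image_of_mem f hx))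
  · exact min_le_of_left_le (hKf hx)

theorem exists_div_one_add_norm_le_exp (hm : 2 ≤ m) (hE : finrank ℝ E = 2 * m)
    (hu : ContDiff ℝ ∞ u) (hQ : Integrable ((fun f ↦ -Δ f)^[m] u)) (hc : 0 < c)
    (h : ∀ x, R₀ ≤ ‖x‖ → c * ‖fderiv ℝ u x‖ ^ 2 ≤ -Δ u x)
    (hlt : ∫ x, (fun f ↦ -Δ f)^[m] u x <
      (volume : Measure E).toSphere.real univ * (2 ^ (m - 1) * (m - 1).factorial) ^ 2) :
    ∃ a > 0, ∀ x, a / (1 + ‖x‖) ≤ Real.exp (u x) := by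
  have : Nontrivial E := nontrivial_of_finrank_pos (R := ℝ) (by omega)
  have hflux : -1 < -((∫ x, (fun f ↦ -Δ f)^[m] u x) / (volume : Measure E).toSphere.real univ /
      (2 ^ (m - 1) * (m - 1).factorial) ^ 2) := by
    rwa [neg_lt_neg_iff, div_div, div_lt_one (mul_pos toSphere_real_univ_pos (by positivity))]
  obtain ⟨C₁, hC₁⟩ := exists_eventually_mul_log_sub_le_sphereMean (b := -1)
    (contDiff_infty.1 hu 1) (((tendsto_mul_sphereFlux (by omega) hE hu hQ hc
      h).eventually_const_lt hflux).mono fun _ ↦ le_of_lt)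
  obtain ⟨C₂, hC₂⟩ := exists_eventually_neg_log_one_add_norm_sub_le (by omega) hc
    (contDiff_infty.1 hu 2) h (by simpa only [neg_one_mul] using hC₁)
  have hcont : Continuous fun x ↦ u x + Real.log (1 + ‖x‖) :=
    hu.continuous.add ((by fun_prop : Continuous fun x : E ↦ 1 + ‖x‖).log fun x ↦ by positivity)
  obtain ⟨b, hb⟩ := bddBelow_range_of_eventually_cocompact_le hcont (b := -C₂)
    (hC₂.mono fun x hx ↦ by linarith)
  refine ⟨Real.exp b, Real.exp_pos b, fun x ↦ ?_⟩
  rw [div_le_iff₀ (by positivity), ← Real.exp_log (by positivity : 0 < 1 + ‖x‖), ← Real.exp_add,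
    Real.exp_le_exp]
  exact hb (mem_range_self x)

end Asymptotics

theorem qCurvature_mul_exp {n : ℕ} (u : Euc n → ℝ) (x : Euc n) :
    qCurvature u x * Real.exp (n * u x) = (fun f : Euc n → ℝ ↦ -Δ f)^[n / 2] u x := by
  rw [qCurvature, mul_right_comm, ← Real.exp_add, neg_add_cancel, Real.exp_zero, one_mul]

theorem mainTheorem11 (n : ℕ) (hn : 4 ≤ n) (hn_even : Even n)
    (u : Euc n → ℝ) (hu : ContDiff ℝ ∞ u)
    (hQ : Integrable (fun x => qCurvature u x * Real.exp (n * u x)))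
    (hR : ∃ K : Set (Euc n), IsCompact K ∧
      ∀ x ∉ K, 0 ≤ scalarCurvature (conformalMetric u) x)
    (hlt : ∫ x, qCurvature u x * Real.exp (n * u x) <
      ((n - 1).factorial : ℝ) * sphereVolume n / 2) :
    IsCompleteMetric (conformalMetric u) := by
  obtain ⟨m, rfl⟩ := hn_even.two_dvd
  simp_rw [qCurvature_mul_exp, Nat.mul_div_cancel_left m two_pos] at hQ hlt
  rw [factorial_mul_sphereVolume (by omega)] at hlt
  obtain ⟨K, hK, hKR⟩ := hR
  obtain ⟨R, hKnorm⟩ := hK.isBounded.exists_norm_le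
  have hc : (0 : ℝ) < (((2 * m : ℕ) : ℝ) - 2) / 2 := by
    have : (4 : ℝ) ≤ (2 * m : ℕ) := by exact_mod_cast hn
    linarith
  have hgrad (x : Euc (2 * m)) (hx : R + 1 ≤ ‖x‖) :
      (((2 * m : ℕ) : ℝ) - 2) / 2 * ‖fderiv ℝ u x‖ ^ 2 ≤ -Δ u x :=
    norm_fderiv_sq_le_neg_laplacian_of_scalarCurvature_nonneg (by omega)
      (contDiff_infty.1 hu 2) (hKR x fun hxK ↦ by linarith [hKnorm x hxK])
  obtain ⟨a, ha, hau⟩ := exists_div_one_add_norm_le_exp (by omega) finrank_euclideanSpace_fin hu hQ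
    hc hgrad hlt
  exact isCompleteMetric_of_div_one_add_norm_le hu.continuous ha hau
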